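/- Let $K\ge 2$, let $P\in[0,1]^{K\times K}$ be a preference matrix ($P(k,k')+P(k',k)=1$) with a Condorcet winner $k^{cw}$, i.e. $P(k^{cw},k)>1/2$ for all $k\ne k^{cw}$, and put $\Delta_k:=P(k^{cw},k)-\tfrac12$ and $\Delta_{\min}:=\min_{k\neq k^{cw}}\Delta_k$. *Environment.* In each round $t\ge1$ there are true duel outcomes $o_t(k,k')=1-o_t(k',k)$, with values in $\{0,1\}$ for $k\ne k'$ and $o_t(k,k)=\tfrac12$, such that conditionally on the past $o_t(k,k')$ has mean $P(k,k')$. An adversary, who may randomize and who sees the past and $o_t$ but not the arms drawn in round $t$, replaces them by $\tilde o_t(k,k')\in[0,1]$ with $\tilde o_t(k,k')=1-\tilde o_t(k',k)$. For an arm $k$ put $$C_T(k):=\sum_{t=1}^T\sum_{k'\ne k}\big|o_t(k,k')-\tilde o_t(k,k')\big| .$$ *Algorithm.* Let $\Psi_t(w)=-2\sqrt t\sum_{k=1}^K(\sqrt{w_k}-w_k/2)$, and let $\mathcal I_\Delta$ be the convex indicator function of the probability simplex. Each player $i\in\{+1,-1\}$ starts with $\hat L_{i,0}=0\in\mathbb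 R^K$. In round $t=1,2,\dots$ it computes $p_{i,t}=\nabla(\Psi_t+\mathcal I_\Delta)^*(-\hat L_{i,t-1})$; conditionally on the past and on $(o_t,\tilde o_t)$, the two players draw arms $k_{+1,t}\sim p_{+1,t}$ and $k_{-1,t}\sim p_{-1,t}$ independently. Only $\tilde o_t(k_{+1,t},k_{-1,t})$ is observed, and $\hat L_{i,t}=\hat L_{i,t-1}+\hat\ell_{i,t}$, where $\hat\ell_{i,t}(k)=\tilde o_t(k_{-i,t},k_{i,t})/p_{i,t}(k)$ for $k=k_{i,t}$ and $\hat\ell_{i,t}(k)=0$ otherwise. *Claim.* Let $T\ge1$ and $R_T(k):=\sum_{t=1}^T\tfrac12\big(P(k,k_{+1,t})+P(k,k_{-1,t})-1\big)$. If $C\in\mathbb R$ and $\mathbf E[C_T(k^{cw})]\le C$ (in particular if $C_T(k^{cw})\le C$ almost surely), then $$\mathbf E[R_T(k^{cw})]\;\le\;\sum_{k\ne k^{cw}}\frac{4\log T+12}{\Delta_k}+4\log T+\frac1{\Delta_{\min}}+\frac32\sqrt K+8+2C .$$ If moreover $\mathbf E[C_T(k)]\le C$ for every arm $k$, then $\max_{k}\mathbf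 E[R_T(k)]$ is bounded by the same right-hand side. -/

import Mathlib

open MeasureTheory

namespace DuelingBandits

/-- The `1/2`-Tsallis regularizer of round `t`, with learning rate `2 / √t`:
`Ψ_t(w) = -2 √t ∑ₖ (√wₖ - wₖ / 2)`. -/
noncomputable def regularizer {K : ℕ} (t : ℕ) (w : Fin K → ℝ) : ℝ :=
  -(2 * √(t : ℝ) * ∑ k, (√(w k) - w k / 2))

/-- The convex conjugate `(Ψ_t + I_Δ)^*` of the regularizer restricted to the probability simplex. -/
noncomputable def conjugate {K : ℕ} (t : ℕ) (y : Fin K → ℝ) : ℝ :=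
  ⨆ w : stdSimplex ℝ (Fin K), (∑ k, (w : Fin K → ℝ) k * y k - regularizer t (w : Fin K → ℝ))

/-- The sampling weights `∇(Ψ_t + I_Δ)^*(-L)` computed from the cumulative loss estimates `L`. -/
noncomputable def weights {K : ℕ} (t : ℕ) (L : Fin K → ℝ) : Fin K → ℝ :=
  fun k => fderiv ℝ (conjugate t) (-L) (Pi.single k 1)

theorem regularizer_continuous {K : ℕ} (t : ℕ) :
    Continuous (regularizer t : (Fin K → ℝ) → ℝ) := by
  unfold regularizer
  fun_prop

/-- The objective `⟨w, y⟩ - Ψ_t(w)` has a unique maximizer on the simplex. -/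
theorem exists_strict_max {K : ℕ} [NeZero K] {t : ℕ} (ht : 0 < t) (y : Fin K → ℝ) :
    ∃ w ∈ stdSimplex ℝ (Fin K), ∀ v ∈ stdSimplex ℝ (Fin K), v ≠ w →
      ∑ k, v k * y k - regularizer t v < ∑ k, w k * y k - regularizer t w := by
  have hc : Continuous (fun w : Fin K → ℝ => ∑ k, w k * y k - regularizer t w) := by
    have := regularizer_continuous (K := K) t
    fun_prop
  obtain ⟨w, hw, hmax⟩ := (isCompact_stdSimplex ℝ (Fin K)).exists_isMaxOn
    ⟨_, single_mem_stdSimplex ℝ (0 : Fin K)⟩ hc.continuousOn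
  refine ⟨w, hw, fun v hv hne => ?_⟩
  have hle : ∑ k, v k * y k - regularizer t v ≤ ∑ k, w k * y k - regularizer t w := hmax hv
  refine lt_of_le_of_ne hle fun heq => ?_
  set u : Fin K → ℝ := fun k => 2⁻¹ * v k + 2⁻¹ * w k with hu
  have hus : u ∈ stdSimplex ℝ (Fin K) :=
    convex_stdSimplex ℝ (Fin K) hv hw (by norm_num) (by norm_num) (by norm_num)
  have hule : ∑ k, u k * y k - regularizer t u ≤ ∑ k, w k * y k - regularizer t w := hmax hus
  have hsq : ∑ k, (2⁻¹ * √(v k) + 2⁻¹ * √(w k)) < ∑ k, √(u k) := by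
    apply Finset.sum_lt_sum
    · intro k _
      exact Real.strictConcaveOn_sqrt.concaveOn.2 (hv.1 k) (hw.1 k)
        (by norm_num : (0 : ℝ) ≤ 2⁻¹) (by norm_num : (0 : ℝ) ≤ 2⁻¹) (by norm_num)
    · obtain ⟨k, hk⟩ := Function.ne_iff.mp hne
      exact ⟨k, Finset.mem_univ _, Real.strictConcaveOn_sqrt.2 (hv.1 k) (hw.1 k) hk
        (by norm_num : (0 : ℝ) < 2⁻¹) (by norm_num : (0 : ℝ) < 2⁻¹) (by norm_num)⟩
  have hst : 0 < √(t : ℝ) := Real.sqrt_pos.mpr (by exact_mod_cast ht)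
  have h1 : ∑ k, u k * y k = 2⁻¹ * ∑ k, v k * y k + 2⁻¹ * ∑ k, w k * y k := by
    rw [Finset.mul_sum, Finset.mul_sum, ← Finset.sum_add_distrib]
    exact Finset.sum_congr rfl fun k _ => by simp only [hu]; ring
  have h2 : ∀ z ∈ stdSimplex ℝ (Fin K),
      regularizer t z = -(2 * √(t : ℝ) * (∑ k, √(z k) - 1 / 2)) := by
    intro z hz
    rw [regularizer, Finset.sum_sub_distrib, ← Finset.sum_div, hz.2]
  rw [h2 v hv, h2 w hw] at heq
  rw [h2 u hus, h2 w hw, h1] at hule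
  rw [Finset.sum_add_distrib, ← Finset.mul_sum, ← Finset.mul_sum] at hsq
  nlinarith [mul_lt_mul_of_pos_left hsq hst]

theorem conjugate_eq {K : ℕ} {t : ℕ} {y w : Fin K → ℝ} (hw : w ∈ stdSimplex ℝ (Fin K))
    (h : ∀ v ∈ stdSimplex ℝ (Fin K), v ≠ w →
      ∑ k, v k * y k - regularizer t v < ∑ k, w k * y k - regularizer t w) :
    conjugate t y = ∑ k, w k * y k - regularizer t w := by
  have hle : ∀ v : stdSimplex ℝ (Fin K),
      ∑ k, (v : Fin K → ℝ) k * y k - regularizer t (v : Fin K → ℝ) ≤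
        ∑ k, w k * y k - regularizer t w := by
    intro v
    by_cases hv : (v : Fin K → ℝ) = w
    · rw [hv]
    · exact (h v v.2 hv).le
  have : Nonempty (stdSimplex ℝ (Fin K)) := ⟨⟨w, hw⟩⟩
  apply le_antisymm
  · exact ciSup_le hle
  · exact le_ciSup (f := fun v : stdSimplex ℝ (Fin K) =>
      ∑ k, (v : Fin K → ℝ) k * y k - regularizer t (v : Fin K → ℝ))
      ⟨_, Set.forall_mem_range.mpr hle⟩ ⟨w, hw⟩

/-- The conjugate is differentiable, and its gradient is the maximizer. -/
theorem hasFDerivAt_conjugate {K : ℕ} [NeZero K] {t : ℕ} (ht : 0 < t) {y w : Fin K → ℝ}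
    (hw : w ∈ stdSimplex ℝ (Fin K))
    (h : ∀ v ∈ stdSimplex ℝ (Fin K), v ≠ w →
      ∑ k, v k * y k - regularizer t v < ∑ k, w k * y k - regularizer t w) :
    HasFDerivAt (conjugate t)
      (∑ k, w k • (ContinuousLinearMap.proj k : (Fin K → ℝ) →L[ℝ] ℝ)) y := by
  have hK : (0 : ℝ) < K := by exact_mod_cast Nat.pos_of_ne_zero (NeZero.ne K)
  have hbd : ∀ v ∈ stdSimplex ℝ (Fin K), ∀ z : Fin K → ℝ, |∑ k, v k * z k| ≤ ‖z‖ := by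
    intro v hv z
    calc |∑ k, v k * z k| ≤ ∑ k, |v k * z k| := Finset.abs_sum_le_sum_abs _ _
      _ ≤ ∑ k, v k * ‖z‖ := by
        refine Finset.sum_le_sum fun k _ => ?_
        rw [abs_mul, abs_of_nonneg (hv.1 k)]
        exact mul_le_mul_of_nonneg_left (norm_le_pi_norm z k) (hv.1 k)
      _ = ‖z‖ := by rw [← Finset.sum_mul, hv.2, one_mul]
  rw [hasFDerivAt_iff_isLittleO_nhds_zero, Asymptotics.isLittleO_iff]
  intro c hc
  have hcK : 0 < c / K := div_pos hc hK
  have hcont : Continuous (fun v : Fin K → ℝ => ∑ k, v k * y k - regularizer t v) := by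
    have := regularizer_continuous (K := K) t
    fun_prop
  -- a gap of the objective away from the maximizer
  have hgap : ∃ η > 0, ∀ v ∈ stdSimplex ℝ (Fin K), c / K ≤ ‖v - w‖ →
      ∑ k, v k * y k - regularizer t v + η ≤ ∑ k, w k * y k - regularizer t w := by
    have hcl : IsClosed {v : Fin K → ℝ | c / K ≤ ‖v - w‖} :=
      isClosed_le continuous_const (by fun_prop)
    have hcpt := (isCompact_stdSimplex ℝ (Fin K)).inter_right hcl
    rcases (stdSimplex ℝ (Fin K) ∩ {v | c / K ≤ ‖v - w‖}).eq_empty_or_nonempty with he | hne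
    · refine ⟨1, one_pos, fun v hv hvw => ?_⟩
      exact absurd (show v ∈ stdSimplex ℝ (Fin K) ∩ {v | c / K ≤ ‖v - w‖} from ⟨hv, hvw⟩)
        (by rw [he]; exact Set.notMem_empty v)
    · obtain ⟨v0, hv0, hmax⟩ := hcpt.exists_isMaxOn hne hcont.continuousOn
      have hne0 : v0 ≠ w := by
        rintro rfl
        have := hv0.2
        simp only [Set.mem_ofPred_eq, sub_self, norm_zero] at this
        linarith
      refine ⟨_, sub_pos.mpr (h v0 hv0.1 hne0), fun v hv hvw => ?_⟩
      have : ∑ k, v k * y k - regularizer t v ≤ ∑ k, v0 k * y k - regularizer t v0 :=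
        hmax ⟨hv, hvw⟩
      linarith
  obtain ⟨η, hη, hgap⟩ := hgap
  filter_upwards [Metric.ball_mem_nhds (0 : Fin K → ℝ) (half_pos (half_pos hη))] with z hz
  have hz' : ‖z‖ < η / 2 / 2 := by simpa using hz
  obtain ⟨v, hv, hvmax⟩ := exists_strict_max ht (y + z)
  rw [conjugate_eq hv hvmax, conjugate_eq hw h]
  have hsplit : ∀ u : Fin K → ℝ, ∑ k, u k * (y + z) k = ∑ k, u k * y k + ∑ k, u k * z k := by
    intro u
    rw [← Finset.sum_add_distrib]
    exact Finset.sum_congr rfl fun k _ => by rw [Pi.add_apply]; ring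
  have hge : ∑ k, w k * (y + z) k - regularizer t w ≤
      ∑ k, v k * (y + z) k - regularizer t v := by
    by_cases hwv : w = v
    · rw [hwv]
    · exact (hvmax w hw hwv).le
  have hle : ∑ k, v k * y k - regularizer t v ≤ ∑ k, w k * y k - regularizer t w := by
    by_cases hvw : v = w
    · rw [hvw]
    · exact (h v hv hvw).le
  have happ : (∑ k, w k • (ContinuousLinearMap.proj k : (Fin K → ℝ) →L[ℝ] ℝ)) z =
      ∑ k, w k * z k := by
    simp
  rw [happ]
  rw [hsplit, hsplit] at hge
  rw [hsplit]
  have hclose : ‖v - w‖ < c / K := by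
    by_contra hcon
    have := hgap v hv (not_lt.mp hcon)
    have h1 := abs_le.mp (hbd v hv z)
    have h2 := abs_le.mp (hbd w hw z)
    linarith [h1.2, h2.1]
  have hdiff : ∑ k, v k * z k - ∑ k, w k * z k ≤ c * ‖z‖ := by
    rw [← Finset.sum_sub_distrib]
    calc ∑ k, (v k * z k - w k * z k) ≤ ∑ _k : Fin K, (c / K) * ‖z‖ := by
          refine Finset.sum_le_sum fun k _ => ?_
          rw [← sub_mul]
          refine (le_abs_self _).trans ?_
          rw [abs_mul]
          exact mul_le_mul ((norm_le_pi_norm (v - w) k).trans hclose.le)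
            (norm_le_pi_norm z k) (abs_nonneg _) hcK.le
      _ = c * ‖z‖ := by
          rw [Finset.sum_const, Finset.card_univ, Fintype.card_fin, nsmul_eq_mul]
          field_simp
  rw [Real.norm_eq_abs, abs_le]
  constructor <;> nlinarith [norm_nonneg z]

/-- The sampling weights are the unique maximizer over the simplex of `⟨w, -L⟩ - Ψ_t(w)`. -/
theorem weights_spec {K : ℕ} [NeZero K] {t : ℕ} (ht : 0 < t) (L : Fin K → ℝ) :
    weights t L ∈ stdSimplex ℝ (Fin K) ∧
      ∀ v ∈ stdSimplex ℝ (Fin K), v ≠ weights t L →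
        ∑ k, v k * (-L) k - regularizer t v <
          ∑ k, weights t L k * (-L) k - regularizer t (weights t L) := by
  obtain ⟨w, hw, h⟩ := exists_strict_max ht (-L)
  have : weights t L = w := by
    funext k
    rw [weights, (hasFDerivAt_conjugate ht hw h).fderiv]
    simp [Pi.single_apply]
  rw [this]
  exact ⟨hw, h⟩

/-- The importance-weighted loss estimate: sampling weights `p`, arm drawn `a`, loss observed `l`. -/
noncomputable def lossEstimate {K : ℕ} (p : Fin K → ℝ) (a : Fin K) (l : ℝ) : Fin K → ℝ :=
  fun k => if k = a then l / p k else 0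

/-- The cumulative loss estimates of one player after `t` rounds, from the arms `a s` it has drawn
and the losses `l s` it has observed in the rounds `s = 1, …, t`. -/
noncomputable def cumLoss {K : ℕ} (a : ℕ → Fin K) (l : ℕ → ℝ) : ℕ → Fin K → ℝ
  | 0 => 0
  | t + 1 => cumLoss a l t +
      lossEstimate (weights (t + 1) (cumLoss a l t)) (a (t + 1)) (l (t + 1))

/-- The distribution from which player `i ∈ {1, -1}` draws its arm in round `t ≥ 1`, when `arm j s`
is the arm drawn by player `j` in round `s` and `x s` is the matrix of the outcomes that are shown:
the loss observed by player `i` is `x s (arm (-i) s) (arm i s)`. -/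
noncomputable def playDist {Ω : Type*} {K : ℕ} (arm : ℤˣ → ℕ → Ω → Fin K)
    (x : ℕ → Ω → Matrix (Fin K) (Fin K) ℝ) (i : ℤˣ) (t : ℕ) (ω : Ω) : Fin K → ℝ :=
  weights t (cumLoss (fun s => arm i s ω) (fun s => x s ω (arm (-i) s ω) (arm i s ω)) (t - 1))

/-- `P k k'` is the probability that `k` is preferred over `k'`. -/
structure IsPreferenceMatrix {K : ℕ} (P : Matrix (Fin K) (Fin K) ℝ) : Prop where
  mem_Icc : ∀ k k', P k k' ∈ Set.Icc (0 : ℝ) 1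
  add_swap : ∀ k k', P k k' + P k' k = 1

/-- The arm `k₀` beats every other arm with probability more than `1/2`. -/
def IsCondorcetWinner {K : ℕ} (P : Matrix (Fin K) (Fin K) ℝ) (k₀ : Fin K) : Prop :=
  ∀ k, k ≠ k₀ → 1 / 2 < P k₀ k

/-- The gap `Δₖ = P(k₀, k) - 1/2`. -/
noncomputable def gap {K : ℕ} (P : Matrix (Fin K) (Fin K) ℝ) (k₀ k : Fin K) : ℝ :=
  P k₀ k - 1 / 2

/-- The smallest gap `Δ_min` of an arm other than `k₀`. -/
noncomputable def minGap {K : ℕ} (P : Matrix (Fin K) (Fin K) ℝ) (k₀ : Fin K) : ℝ :=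
  ⨅ k : {k : Fin K // k ≠ k₀}, gap P k₀ k

/-- A run of the two-player algorithm in the stochastic environment `P` with corruptions.
`o t` and `x t` are the matrices of the true and of the corrupted outcomes in round `t`, and
`arm i t` is the arm drawn by player `i ∈ {1, -1}`. `F t` is everything that has happened up to the
end of round `t`, and `G t` is everything known in round `t` just before the two arms are drawn, the
outcomes `o t` and `x t` included: the adversary sees the past and the true outcomes of the round,
and may randomize, but does not see the arms drawn in the round. -/
structure IsCorruptedRun {Ω : Type*} {mΩ : MeasurableSpace Ω} {K : ℕ} (μ : Measure Ω)
    (P : Matrix (Fin K) (Fin K) ℝ) (F : Filtration ℕ mΩ) (G : ℕ → MeasurableSpace Ω)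
    (o x : ℕ → Ω → Matrix (Fin K) (Fin K) ℝ) (arm : ℤˣ → ℕ → Ω → Fin K) : Prop where
  le_G : ∀ t, 1 ≤ t → F (t - 1) ≤ G t
  G_le : ∀ t, 1 ≤ t → G t ≤ F t
  measurable_o : ∀ t, 1 ≤ t → ∀ k k', Measurable[G t] fun ω => o t ω k k'
  measurable_x : ∀ t, 1 ≤ t → ∀ k k', Measurable[G t] fun ω => x t ω k k'
  measurable_arm : ∀ t, 1 ≤ t → ∀ i, Measurable[F t] (arm i t)
  /-- True outcomes are binary, and a duel of an arm with itself has the outcome `1/2`. -/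
  o_binary : ∀ t, 1 ≤ t → ∀ ω k k', k ≠ k' → o t ω k k' = 0 ∨ o t ω k k' = 1
  o_swap : ∀ t, 1 ≤ t → ∀ ω k k', o t ω k k' = 1 - o t ω k' k
  /-- Given the past, the outcome of the duel of `k` and `k'` has mean `P k k'`. -/
  o_law : ∀ t, 1 ≤ t → ∀ k k', μ[fun ω => o t ω k k' | F (t - 1)] =ᵐ[μ] fun _ => P k k'
  /-- Corrupted outcomes are arbitrary in `[0, 1]`, in particular they may be binary. -/
  x_mem_Icc : ∀ t, 1 ≤ t → ∀ ω k k', x t ω k k' ∈ Set.Icc (0 : ℝ) 1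
  x_swap : ∀ t, 1 ≤ t → ∀ ω k k', x t ω k k' = 1 - x t ω k' k
  /-- The two players draw their arms independently from their sampling distributions. -/
  arm_law : ∀ t, 1 ≤ t → ∀ a b,
    μ[Set.indicator {ω | arm 1 t ω = a ∧ arm (-1) t ω = b} (fun _ => (1 : ℝ)) | G t]
      =ᵐ[μ] fun ω => playDist arm x 1 t ω a * playDist arm x (-1) t ω b

/-- The total amount of corruption, over `T` rounds, of the duels of the arm `k` with others. -/
noncomputable def corruption {Ω : Type*} {K : ℕ} (o x : ℕ → Ω → Matrix (Fin K) (Fin K) ℝ)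
    (T : ℕ) (k : Fin K) (ω : Ω) : ℝ :=
  ∑ t ∈ Finset.Icc 1 T, ∑ k' ∈ Finset.univ.erase k, |o t ω k k' - x t ω k k'|

/-- The regret `R_T(k)` with respect to the arm `k`, measured with the true preferences. -/
noncomputable def regret {Ω : Type*} {K : ℕ} (P : Matrix (Fin K) (Fin K) ℝ)
    (arm : ℤˣ → ℕ → Ω → Fin K) (T : ℕ) (k : Fin K) (ω : Ω) : ℝ :=
  ∑ t ∈ Finset.Icc 1 T, 1 / 2 * (P k (arm 1 t ω) + P k (arm (-1) t ω) - 1)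

end DuelingBandits

namespace DuelingBandits

/-! Each player runs follow-the-regularized-leader (FTRL) against the other, and a self-bounding
argument turns the two regret guarantees into a logarithmic bound.

Single player. Let `Φ_t` be the conjugate. Telescoping `Φ_t(-L)` along the run bounds the regret on
every path by a penalty, caused by the growth of `√t`, plus a stability term (`conjugate_stability`,
`regret_pathwise`). Averaging the stability term over the drawn arm gives `∑ √w_j (1 - w_j) / √t +
2/t` (`stability_expectation`); `roundBound` collects penalty and averaged stability.

Reduction. The loss estimates are unbiased, and the two observed losses of a round add up to 1. The
two estimated regrets against an arm `k` therefore add up, in expectation, to the duelling regret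
measured with the corrupted outcomes. Passing to the true preferences costs at most the corruption
of the duels of `k`. With `A` half the sum of the two expected totals of `roundBound`, every arm
satisfies `E R(k) ≤ A + E C(k)` (`integral_regret_le`).

Self-bounding. For the Condorcet winner, `E R` equals half the sum over players, rounds and arms of
the expected `Δ_k p_k` (`integral_preference_eq`). In `2 * roundBound` the winner can be eliminated,
leaving for every other arm a leading term `4 √p_k / √t`, and `4 √p_k / √t - Δ_k p_k ≤ 4 / (Δ_k t)`.
Lower-order terms sum to a multiple of `1 / Δ_k`, so `2 A - E R ≤ B` with `B` logarithmic
(`self_bounding`). Combined with `E R ≤ A + C` this gives `A ≤ B + C`, hence `E R(k) ≤ B + 2 C` for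
each arm whose expected corruption is at most `C`. -/

theorem le_conjugate {K : ℕ} (t : ℕ) (y : Fin K → ℝ) {v : Fin K → ℝ}
    (hv : v ∈ stdSimplex ℝ (Fin K)) :
    ∑ k, v k * y k - regularizer t v ≤ conjugate t y := by
  have hc : Continuous (fun w : Fin K → ℝ => ∑ k, w k * y k - regularizer t w) := by
    have := regularizer_continuous (K := K) t
    fun_prop
  have hb := (isCompact_stdSimplex ℝ (Fin K)).bddAbove_image hc.continuousOn
  rw [Set.image_eq_range] at hb
  exact le_ciSup (f := fun v : stdSimplex ℝ (Fin K) =>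
      ∑ k, (v : Fin K → ℝ) k * y k - regularizer t (v : Fin K → ℝ)) hb ⟨v, hv⟩

theorem regularizer_of_mem {K : ℕ} (t : ℕ) {z : Fin K → ℝ} (hz : z ∈ stdSimplex ℝ (Fin K)) :
    regularizer t z = -(2 * √(t : ℝ) * (∑ k, √(z k) - 1 / 2)) := by
  rw [regularizer, Finset.sum_sub_distrib, ← Finset.sum_div, hz.2]

/-! ### The sampling weights: interiority, first-order condition, lower bound -/

section Weights

variable {K : ℕ} [NeZero K] {t : ℕ}

theorem conjugate_neg_eq (ht : 0 < t) (L : Fin K → ℝ) :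
    conjugate t (-L) =
      ∑ k, weights t L k * (-L) k - regularizer t (weights t L) :=
  conjugate_eq (weights_spec ht L).1 (weights_spec ht L).2

theorem weights_isMax (ht : 0 < t) (L : Fin K → ℝ) {v : Fin K → ℝ}
    (hv : v ∈ stdSimplex ℝ (Fin K)) :
    ∑ k, v k * (-L) k - regularizer t v ≤
      ∑ k, weights t L k * (-L) k - regularizer t (weights t L) :=
  (le_conjugate t (-L) hv).trans_eq (conjugate_neg_eq ht L)

/-- The square root has infinite slope at 0: moving mass `d ^ 2` to an empty arm gains order `d` in
the regularizer and loses only order `d ^ 2` elsewhere. -/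
theorem weights_pos (ht : 0 < t) (L : Fin K → ℝ) (k : Fin K) : 0 < weights t L k := by
  have hw := (weights_spec ht L).1
  set w := weights t L with hwdef
  refine lt_of_le_of_ne (hw.1 k) fun h0 => ?_
  have hst : 0 < √(t : ℝ) := Real.sqrt_pos.mpr (by exact_mod_cast ht)
  set S := ∑ j, √(w j)
  set A := ∑ j, w j * (-L) j
  set M := |2 * √(t : ℝ) * S + A - (-L) k|
  have hM : 0 ≤ M := abs_nonneg _
  -- Chosen so that `d * M < 2 √t`: the gain `2 √t * d` then beats the loss, which is at most `d ^ 2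
  -- * M`.
  set d := √(t : ℝ) / (√(t : ℝ) + M)
  have hd0 : 0 < d := by positivity
  have hd1 : d ≤ 1 := by rw [div_le_one (by positivity)]; linarith
  have hdM : d * M < 2 * √(t : ℝ) := by
    have : d * (√(t : ℝ) + M) = √(t : ℝ) := by simp only [d]; field_simp
    nlinarith [mul_pos hd0 hst]
  have hd2 : d ^ 2 ≤ 1 := pow_le_one₀ hd0.le hd1
  set v : Fin K → ℝ := fun j => (1 - d ^ 2) * w j + d ^ 2 * (Pi.single k (1 : ℝ) : Fin K → ℝ) j
    with hvdef
  have hv : v ∈ stdSimplex ℝ (Fin K) :=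
    convex_stdSimplex ℝ (Fin K) hw (single_mem_stdSimplex ℝ k) (by linarith) (by positivity)
      (by ring)
  have hmax := weights_isMax ht L hv
  rw [← hwdef, regularizer_of_mem t hv, regularizer_of_mem t hw] at hmax
  have hlin : ∑ j, v j * (-L) j = (1 - d ^ 2) * A + d ^ 2 * (-L) k := by
    simp only [hvdef, add_mul, Finset.sum_add_distrib, A, Finset.mul_sum, mul_assoc]
    congr 1
    simp [Pi.single_apply]
  have hS : (1 - d ^ 2) * S + d ≤ ∑ j, √(v j) := by
    have : (1 - d ^ 2) * S + d = ∑ j, ((1 - d ^ 2) * √(w j) + if j = k then d else 0) := by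
      simp [Finset.sum_add_distrib, S, Finset.mul_sum]
    rw [this]
    refine Finset.sum_le_sum fun j _ => ?_
    by_cases hj : j = k
    · subst hj
      simp [hvdef, ← h0, Real.sqrt_sq hd0.le]
    · simp only [hj, if_false, hvdef, Pi.single_apply, mul_zero, add_zero]
      rw [Real.sqrt_mul (by linarith)]
      refine mul_le_mul_of_nonneg_right ?_ (Real.sqrt_nonneg _)
      exact Real.le_sqrt_of_sq_le (by nlinarith [sq_nonneg d])
  rw [hlin] at hmax
  have h1 := mul_le_mul_of_nonneg_left hS hst.le
  have h2 : d * (2 * √(t : ℝ) * S + A - (-L) k) ≤ d * M :=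
    mul_le_mul_of_nonneg_left (le_abs_self _) hd0.le
  nlinarith

/-- The objective is differentiable at its maximizer because all weights are positive, so its
derivative is nonpositive in every direction that stays in the simplex. -/
theorem weights_first_order (ht : 0 < t) (L : Fin K → ℝ) {v : Fin K → ℝ}
    (hv : v ∈ stdSimplex ℝ (Fin K)) :
    ∑ k, (v k - weights t L k) * (-L k - √(t : ℝ) * (1 - 1 / √(weights t L k))) ≤ 0 := by
  have hw := (weights_spec ht L).1
  have hpos := weights_pos ht L
  have hmaxw : IsMaxOn (fun w : Fin K → ℝ => ∑ k, w k * (-L) k - regularizer t w)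
    (stdSimplex ℝ (Fin K)) (weights t L) := fun u hu => weights_isMax ht L hu
  set w := weights t L
  have hmax := hmaxw.localize
  have hd : HasFDerivAt (fun w : Fin K → ℝ => ∑ k, w k * (-L) k - regularizer t w)
      (∑ k, (-L k - √(t : ℝ) * (1 - 1 / √(w k))) •
        (ContinuousLinearMap.proj k : (Fin K → ℝ) →L[ℝ] ℝ)) w := by
    have hterm : ∀ k, HasFDerivAt
        (fun w : Fin K → ℝ => w k * (-L) k + 2 * √(t : ℝ) * (√(w k) - w k / 2))
        ((-L k - √(t : ℝ) * (1 - 1 / √(w k))) •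
          (ContinuousLinearMap.proj k : (Fin K → ℝ) →L[ℝ] ℝ)) w := by
      intro k
      have h1 : HasDerivAt (fun a : ℝ => a * (-L) k + 2 * √(t : ℝ) * (√a - a / 2))
          (1 * (-L) k + 2 * √(t : ℝ) * (1 / (2 * √(w k)) - 1 / 2)) (w k) :=
        ((hasDerivAt_id _).mul_const _).add
          (((Real.hasDerivAt_sqrt (hpos k).ne').sub ((hasDerivAt_id _).div_const 2)).const_mul _)
      have h2 := h1.comp_hasFDerivAt w
        ((ContinuousLinearMap.proj k : (Fin K → ℝ) →L[ℝ] ℝ).hasFDerivAt)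
      refine h2.congr_fderiv ?_
      congr 1
      simp only [Pi.neg_apply]
      field_simp
      ring
    have hsum := HasFDerivAt.fun_sum (u := Finset.univ) fun k _ => hterm k
    refine hsum.congr_of_eventuallyEq (Filter.Eventually.of_forall fun u => ?_)
    beta_reduce
    rw [regularizer, sub_neg_eq_add, Finset.mul_sum, ← Finset.sum_add_distrib]
  have hle := hmax.hasFDerivWithinAt_nonpos hd.hasFDerivWithinAt
    (sub_mem_posTangentConeAt_of_segment_subset ((convex_stdSimplex ℝ (Fin K)).segment_subset hw hv))
  refine le_trans (le_of_eq ?_) hle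
  simp [mul_comm]

theorem weights_lt_one (hK : 2 ≤ K) (ht : 0 < t) (L : Fin K → ℝ) (k : Fin K) :
    weights t L k < 1 := by
  have : Nontrivial (Fin K) := Fin.nontrivial_iff_two_le.mpr hK
  obtain ⟨j, hj⟩ := exists_ne k
  have hsum := (weights_spec ht L).1.2
  rw [← Finset.add_sum_erase _ _ (Finset.mem_univ k)] at hsum
  have : 0 < ∑ i ∈ Finset.univ.erase k, weights t L i :=
    Finset.sum_pos (fun i _ => weights_pos ht L i) ⟨j, by simp [hj]⟩
  linarith

/-- The sampling weights are bounded below in terms of the size of the loss estimates. -/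
theorem weights_ge (ht : 0 < t) {L : Fin K → ℝ} {M : ℝ} (h0 : ∀ k, 0 ≤ L k)
    (hM : ∀ k, L k ≤ M) (k : Fin K) :
    ((√(K : ℝ) + M / √(t : ℝ)) ^ 2)⁻¹ ≤ weights t L k := by
  have hst : 0 < √(t : ℝ) := Real.sqrt_pos.mpr (by exact_mod_cast ht)
  have hK : (0 : ℝ) < K := by exact_mod_cast Nat.pos_of_ne_zero (NeZero.ne K)
  have hw := (weights_spec ht L).1
  have hpos := weights_pos ht L
  have hfo := fun v (hv : v ∈ stdSimplex ℝ (Fin K)) => weights_first_order ht L hv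
  set w := weights t L
  -- By pigeonhole some arm `j` has weight at least `1 / K`. Testing the first-order condition on
  -- the transfer of all its mass to `k` compares the two partial derivatives.
  obtain ⟨j, hj⟩ : ∃ j, (K : ℝ)⁻¹ ≤ w j := by
    by_contra! hcon
    have h1 : ∑ i, w i < ∑ _i : Fin K, (K : ℝ)⁻¹ :=
      Finset.sum_lt_sum_of_nonempty ⟨k, Finset.mem_univ k⟩ fun i _ => hcon i
    rw [hw.2] at h1
    simp [hK.ne'] at h1
  have hM0 : 0 ≤ M := (h0 k).trans (hM k)
  have hsw : 0 < √(w k) := Real.sqrt_pos.mpr (hpos k)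
  have key : 1 / √(w k) ≤ √(K : ℝ) + M / √(t : ℝ) := by
    have hjs : 1 / √(w j) ≤ √(K : ℝ) := by
      rw [one_div, ← Real.sqrt_inv]
      exact Real.sqrt_le_sqrt (inv_le_of_inv_le₀ hK hj)
    by_cases hjk : j = k
    · subst hjk
      have : 0 ≤ M / √(t : ℝ) := by positivity
      linarith
    have hv : (w + (Pi.single k (w j) - Pi.single j (w j)) : Fin K → ℝ) ∈ stdSimplex ℝ (Fin K) := by
      constructor
      · intro i
        by_cases hik : i = k
        · subst hik
          simp [Ne.symm hjk]
          linarith [hw.1 i, hw.1 j]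
        · by_cases hij : i = j
          · subst hij; simp [hik]
          · simp [hik, hij, hw.1 i]
      · simp [Finset.sum_add_distrib, hw.2]
    have h := hfo _ hv
    simp only [Pi.add_apply, Pi.sub_apply, add_sub_cancel_left, sub_mul, Finset.sum_sub_distrib]
      at h
    simp only [Pi.single_apply, ite_mul, zero_mul, Finset.sum_ite_eq', Finset.mem_univ, if_true]
      at h
    rw [← mul_sub] at h
    have h' := nonpos_of_mul_nonpos_right h (hpos j)
    have h2 : √(t : ℝ) * (1 / √(w k)) ≤ √(t : ℝ) * (√(K : ℝ)) + M := by
      have := mul_le_mul_of_nonneg_left hjs hst.le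
      linarith [h0 j, hM k]
    calc 1 / √(w k) = (√(t : ℝ) * (1 / √(w k))) / √(t : ℝ) := by field_simp
      _ ≤ (√(t : ℝ) * (√(K : ℝ)) + M) / √(t : ℝ) := by gcongr
      _ = _ := by field_simp
  calc ((√(K : ℝ) + M / √(t : ℝ)) ^ 2)⁻¹ ≤ ((1 / √(w k)) ^ 2)⁻¹ := by gcongr
    _ = w k := by rw [one_div, inv_pow, inv_inv, Real.sq_sqrt (hpos k).le]

end Weights

/-! ### Stability of one FTRL step and the pathwise regret bound -/

/-- Here `s = 1/√t`, while `b` and `a` are the square roots of the old and new weights; `(a - b) ^ 2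
/ (s * b)` is the Bregman divergence of one coordinate. With `a = b + d s b` the quadratic loss term
has a favourable sign, and the rest is a completed square in `d`. -/
theorem drawn_arm_stability {s a b l : ℝ} (hs : 0 < s) (hb : 0 < b) (hb1 : b ≤ 1)
    (hl : l ∈ Set.Icc (0 : ℝ) 1) :
    -(a ^ 2 - b ^ 2) * (l * (1 / b ^ 2 - 1)) - (a - b) ^ 2 / (s * b) ≤ s * (1 - b ^ 2) ^ 2 / b := by
  set c := 1 / b ^ 2 - 1 with hc
  have hc0 : 0 ≤ c := by
    rw [hc, sub_nonneg, le_div_iff₀ (by positivity)]; nlinarith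
  have hcb : c * b ^ 2 = 1 - b ^ 2 := by rw [hc]; field_simp
  have h1 : s * (1 - b ^ 2) ^ 2 / b = s * b ^ 3 * c ^ 2 := by
    rw [← hcb]; field_simp
  have h2 : (a - b) ^ 2 / (s * b) = ((a - b) / (s * b)) ^ 2 * (s * b) := by field_simp
  have h3 : a = b + (a - b) / (s * b) * (s * b) := by field_simp; ring
  rw [h1, h2]
  generalize (a - b) / (s * b) = d at *
  subst h3
  have hlc : (l * c) ^ 2 ≤ c ^ 2 := by
    rw [mul_pow]
    exact mul_le_of_le_one_left (sq_nonneg _) (pow_le_one₀ hl.1 hl.2)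
  have h4 : 0 ≤ (d * (s * b)) ^ 2 * (l * c) := mul_nonneg (sq_nonneg _) (mul_nonneg hl.1 hc0)
  have h5 : 0 ≤ s * b * (d + b * (l * c)) ^ 2 := by positivity
  have h6 := mul_le_mul_of_nonneg_left hlc (by positivity : 0 ≤ s * b ^ 3)
  nlinarith

/-- The centred loss is `-l`, so only an increase of the weight costs anything. Then `a ^ 2 - b ^ 2
= 2 b (a - b) + (a - b) ^ 2`, and the extra square is absorbed by the divergence because `s * b <
1`; this leaves the denominator `1 - s * b`. -/
theorem undrawn_arm_stability {s a b l : ℝ} (hs : 0 < s) (hs1 : s ≤ 1) (ha : 0 ≤ a) (hb : 0 < b)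
    (hb1 : b < 1) (hl : l ∈ Set.Icc (0 : ℝ) 1) :
    -(a ^ 2 - b ^ 2) * (-l) - (a - b) ^ 2 / (s * b) ≤ s * b ^ 3 / (1 - s * b) := by
  have hsb : 0 < 1 - s * b := by nlinarith
  have hR : 0 ≤ s * b ^ 3 / (1 - s * b) := by positivity
  have hQ : 0 ≤ (a - b) ^ 2 / (s * b) := by positivity
  rcases le_total a b with hab | hab
  · have : a ^ 2 ≤ b ^ 2 := by gcongr
    nlinarith [hl.1, mul_nonneg hl.1 (sub_nonneg.mpr this)]
  · have h0 : b ^ 2 ≤ a ^ 2 := by gcongr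
    have h1 : -(a ^ 2 - b ^ 2) * (-l) ≤ a ^ 2 - b ^ 2 := by
      nlinarith [mul_nonneg (sub_nonneg.mpr hl.2) (sub_nonneg.mpr h0)]
    have h2 : (a - b) ^ 2 / (s * b) = ((a - b) / (s * b)) ^ 2 * (s * b) := by field_simp
    have h3 : s * b ^ 3 / (1 - s * b) = s * b * (b / (1 - s * b)) ^ 2 * (1 - s * b) := by
      have := hsb.ne'
      field_simp
    have h4 : a - b = (a - b) / (s * b) * (s * b) := by field_simp
    have h5 : b = b / (1 - s * b) * (1 - s * b) := (div_mul_cancel₀ b hsb.ne').symm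
    have h6 : 0 ≤ s * b * (1 - s * b) * ((a - b) / (s * b) - b / (1 - s * b)) ^ 2 := by positivity
    have h7 : a ^ 2 - b ^ 2 = 2 * ((a - b) / (s * b) * (s * b)) * (b / (1 - s * b) * (1 - s * b))
        + ((a - b) / (s * b) * (s * b)) ^ 2 := by
      rw [← h4, ← h5]; ring
    rw [h2, h3]
    refine (sub_le_sub_right (h1.trans_eq h7) _).trans ?_
    generalize (a - b) / (s * b) = p at *
    generalize b / (1 - s * b) = q at *
    nlinarith

/-- The contribution of an arm that is not drawn to the stability term. -/
noncomputable def undrawnStability {K : ℕ} (t : ℕ) (w : Fin K → ℝ) (j : Fin K) : ℝ :=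
  1 / √(t : ℝ) * √(w j) ^ 3 / (1 - 1 / √(t : ℝ) * √(w j))

/-- The stability term of round `t` when arm `a` is drawn from `w`. -/
noncomputable def stability {K : ℕ} (t : ℕ) (w : Fin K → ℝ) (a : Fin K) : ℝ :=
  1 / √(t : ℝ) * (1 - w a) ^ 2 / √(w a) + ∑ j ∈ Finset.univ.erase a, undrawnStability t w j

theorem inv_sqrt_natCast_le_one {t : ℕ} (ht : 0 < t) : 1 / √(t : ℝ) ≤ 1 := by
  have : (1 : ℝ) ≤ t := by exact_mod_cast ht
  rw [div_le_one (by positivity)]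
  exact Real.one_le_sqrt.mpr this

/-- Both weight vectors sum to 1, so the estimate may be recentred by the observed loss `l`: the
drawn arm then sees `l (1/w - 1)` and the others `-l`. This recentring produces the factor `1 - w`
in the stability term. The objective splits into coordinates, and the first-order condition at the
old weights removes the linear part. -/
theorem conjugate_stability {K : ℕ} [NeZero K] (hK : 2 ≤ K) {t : ℕ} (ht : 0 < t) (L : Fin K → ℝ)
    (a : Fin K) {l : ℝ} (hl : l ∈ Set.Icc (0 : ℝ) 1) :
    l + conjugate t (-(L + lossEstimate (weights t L) a l)) ≤
      conjugate t (-L) + stability t (weights t L) a := by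
  have hst : 0 < √(t : ℝ) := Real.sqrt_pos.mpr (by exact_mod_cast ht)
  have hs : 0 < 1 / √(t : ℝ) := by positivity
  have hs1 := inv_sqrt_natCast_le_one ht
  have hw := (weights_spec ht L).1
  have hpos := weights_pos ht L
  have hlt := weights_lt_one hK ht L
  rw [conjugate_neg_eq ht, conjugate_neg_eq ht]
  set m := lossEstimate (weights t L) a l with hm
  have hv := (weights_spec ht (L + m)).1
  have hfo := weights_first_order ht L hv
  set w := weights t L
  set v := weights t (L + m)
  set s := 1 / √(t : ℝ) with hsdef
  rw [regularizer_of_mem t hw, regularizer_of_mem t hv]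
  have hbound : ∑ j, (-(v j - w j) * (m j - l) - (√(v j) - √(w j)) ^ 2 / (s * √(w j)))
      ≤ stability t w a := by
    rw [stability, ← Finset.add_sum_erase _ _ (Finset.mem_univ a)]
    refine add_le_add ?_ (Finset.sum_le_sum fun j hj => ?_)
    · have hb : 0 < √(w a) := Real.sqrt_pos.mpr (hpos a)
      have h := drawn_arm_stability (a := √(v a)) hs hb
        (Real.sqrt_le_one.mpr (hlt a).le) hl
      rw [Real.sq_sqrt (hv.1 a), Real.sq_sqrt (hw.1 a)] at h
      have : m a - l = l * (1 / w a - 1) := by rw [hm, lossEstimate, if_pos rfl]; ring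
      rw [this]
      exact h
    · have hb : 0 < √(w j) := Real.sqrt_pos.mpr (hpos j)
      have hb1 : √(w j) < 1 := by
        rw [Real.sqrt_lt' one_pos]; simpa using hlt j
      have h := undrawn_arm_stability hs hs1 (Real.sqrt_nonneg (v j)) hb hb1 hl
      rw [Real.sq_sqrt (hv.1 j), Real.sq_sqrt (hw.1 j)] at h
      have : m j - l = -l := by
        rw [hm, lossEstimate, if_neg (Finset.ne_of_mem_erase hj)]; ring
      rw [this]
      exact h
  have hwm : ∑ j, w j * m j = l := by
    simp [hm, lossEstimate, mul_div_cancel₀ _ (hpos a).ne']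
  have hid : ∑ j, (-(v j - w j) * (m j - l) - (√(v j) - √(w j)) ^ 2 / (s * √(w j)))
      = ∑ j, (v j * (-(L + m)) j - w j * (-L) j + w j * m j + l * (v j - w j)
        + 2 * √(t : ℝ) * (√(v j) - √(w j)) - √(t : ℝ) * (v j - w j)
        - (v j - w j) * (-L j - √(t : ℝ) * (1 - 1 / √(w j)))) := by
    refine Finset.sum_congr rfl fun j _ => ?_
    have hb : 0 < √(w j) := Real.sqrt_pos.mpr (hpos j)
    have h1 : (√(v j) - √(w j)) ^ 2 / (s * √(w j))
        = √(t : ℝ) * (v j + w j - 2 * √(v j) * √(w j)) / √(w j) := by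
      rw [sub_sq, Real.sq_sqrt (hv.1 j), Real.sq_sqrt (hw.1 j), hsdef]
      field_simp
      ring
    have h2 : w j / √(w j) = √(w j) := Real.div_sqrt
    have h3 : √(t : ℝ) * (v j + w j - 2 * √(v j) * √(w j)) / √(w j)
       = √(t : ℝ) * ((v j - w j) * (1 / √(w j)) + 2 * (w j / √(w j)) - 2 * √(v j)) := by
      field_simp
      ring
    rw [h1, h3, h2]
    simp only [Pi.neg_apply, Pi.add_apply]
    ring
  have hsplit : ∑ j, (v j * (-(L + m)) j - w j * (-L) j + w j * m j + l * (v j - w j)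
        + 2 * √(t : ℝ) * (√(v j) - √(w j)) - √(t : ℝ) * (v j - w j)
        - (v j - w j) * (-L j - √(t : ℝ) * (1 - 1 / √(w j))))
      = ∑ j, v j * (-(L + m)) j - ∑ j, w j * (-L) j + l
        + 2 * √(t : ℝ) * (∑ j, √(v j) - ∑ j, √(w j))
        - ∑ j, (v j - w j) * (-L j - √(t : ℝ) * (1 - 1 / √(w j))) := by
    simp only [Finset.sum_sub_distrib (G := ℝ), Finset.sum_add_distrib, ← Finset.mul_sum, hwm, hv.2, hw.2]
    ring
  rw [hid, hsplit] at hbound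
  linarith

theorem cumLoss_eq_sum {K : ℕ} (a : ℕ → Fin K) (l : ℕ → ℝ) (T : ℕ) (k : Fin K) :
    cumLoss a l T k = ∑ t ∈ Finset.Icc 1 T,
      lossEstimate (weights t (cumLoss a l (t - 1))) (a t) (l t) k := by
  induction T with
  | zero => simp [cumLoss]
  | succ n ih => rw [Finset.sum_Icc_succ_top (by omega), ← ih]; simp [cumLoss]

/-- The pathwise regret bound for follow-the-regularized-leader against a fixed arm `k`. -/
theorem regret_pathwise {K : ℕ} [NeZero K] (hK : 2 ≤ K) (a : ℕ → Fin K) (l : ℕ → ℝ)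
    (hl : ∀ t, 1 ≤ t → l t ∈ Set.Icc (0 : ℝ) 1) (T : ℕ) (k : Fin K) :
    ∑ t ∈ Finset.Icc 1 T,
        (l t - lossEstimate (weights t (cumLoss a l (t - 1))) (a t) (l t) k) ≤
      ∑ t ∈ Finset.Icc 1 T,
        (2 * (√(t : ℝ) - √((t - 1 : ℕ) : ℝ)) *
            (∑ j, √(weights t (cumLoss a l (t - 1)) j) - 1)
          + stability t (weights t (cumLoss a l (t - 1))) (a t)) := by
  -- The extra `√n` is minus the value of the regularizer at a vertex of the simplex; it cancels
  -- when the conjugate is bounded below at the vertex `k`.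
  have main : ∀ n : ℕ, ∑ t ∈ Finset.Icc 1 n, l t + conjugate n (-cumLoss a l n) ≤
      ∑ t ∈ Finset.Icc 1 n,
        (2 * (√(t : ℝ) - √((t - 1 : ℕ) : ℝ)) *
            (∑ j, √(weights t (cumLoss a l (t - 1)) j) - 1)
          + stability t (weights t (cumLoss a l (t - 1))) (a t)) + √(n : ℝ) := by
    intro n
    induction n with
    | zero =>
      have : Nonempty (stdSimplex ℝ (Fin K)) := ⟨⟨_, single_mem_stdSimplex ℝ (0 : Fin K)⟩⟩
      simp only [conjugate, regularizer, cumLoss]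
      simp
    | succ n ih =>
      rw [Finset.sum_Icc_succ_top (by omega), Finset.sum_Icc_succ_top (by omega)]
      simp only [Nat.add_sub_cancel]
      have h1 := conjugate_stability hK (Nat.succ_pos n) (cumLoss a l n) (a (n + 1))
        (hl (n + 1) (by omega))
      have hw := (weights_spec (Nat.succ_pos n) (cumLoss a l n)).1
      have h2 := le_conjugate n (-cumLoss a l n) hw
      rw [conjugate_neg_eq (Nat.succ_pos n) (cumLoss a l n), regularizer_of_mem _ hw] at h1
      rw [regularizer_of_mem _ hw] at h2
      rw [cumLoss]
      simp only [Nat.succ_eq_add_one] at *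
      linarith
  have h := main T
  have h2 := le_conjugate T (-cumLoss a l T) (single_mem_stdSimplex ℝ k)
  rw [regularizer_of_mem _ (single_mem_stdSimplex ℝ k)] at h2
  have h3 : ∑ j, √((Pi.single k (1 : ℝ) : Fin K → ℝ) j) = 1 := by
    rw [Finset.sum_eq_single k] <;> simp +contextual
  rw [h3] at h2
  have h4 : ∑ j, (Pi.single k (1 : ℝ) : Fin K → ℝ) j * (-cumLoss a l T) j = -cumLoss a l T k := by
    simp [Pi.single_apply]
  rw [h4] at h2
  rw [Finset.sum_sub_distrib, ← cumLoss_eq_sum]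
  linarith

/-- With `b = √w_j`, the leading parts combine as `b (1 - b²)² + b³ (1 - b²) = b (1 - b²)`. The
remainder from the denominator `1 - s b` is harmless even at `t = 1`, where `s = 1`, because `1 - b²
≤ 2 (1 - s b)`. -/
theorem stability_expectation {K : ℕ} {t : ℕ} (ht : 0 < t) {w : Fin K → ℝ}
    (hpos : ∀ k, 0 < w k) (hlt : ∀ k, w k < 1) (hsum : ∑ k, w k = 1) :
    ∑ a, w a * stability t w a ≤
      1 / √(t : ℝ) * ∑ j, √(w j) * (1 - w j) + 2 / t := by
  have hst : 0 < √(t : ℝ) := Real.sqrt_pos.mpr (by exact_mod_cast ht)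
  have hs1 := inv_sqrt_natCast_le_one ht
  have hss : (1 / √(t : ℝ)) ^ 2 = 1 / t := by
    rw [div_pow, one_pow, Real.sq_sqrt (Nat.cast_nonneg t)]
  have hs : 0 < 1 / √(t : ℝ) := by positivity
  have h1 : ∀ a, w a * stability t w a =
      1 / √(t : ℝ) * (1 - w a) ^ 2 * √(w a) - w a * undrawnStability t w a
        + w a * ∑ j, undrawnStability t w j := by
    intro a
    have h := Finset.add_sum_erase Finset.univ (undrawnStability t w) (Finset.mem_univ a)
    rw [stability, eq_sub_of_add_eq' h]
    have h2 : w a * (1 / √(t : ℝ) * (1 - w a) ^ 2 / √(w a))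
        = 1 / √(t : ℝ) * (1 - w a) ^ 2 * (w a / √(w a)) := by ring
    rw [mul_add, h2, Real.div_sqrt]
    ring
  rw [Finset.sum_congr rfl fun a _ => h1 a, Finset.sum_add_distrib, ← Finset.sum_mul, hsum, one_mul,
    ← Finset.sum_add_distrib]
  have h3 : 1 / √(t : ℝ) * ∑ j, √(w j) * (1 - w j) + 2 / t
      = ∑ j, (1 / √(t : ℝ) * (√(w j) * (1 - w j)) + 2 / t * w j) := by
    rw [Finset.sum_add_distrib, ← Finset.mul_sum, ← Finset.mul_sum, hsum, mul_one]
  rw [h3]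
  refine Finset.sum_le_sum fun j _ => ?_
  have hb : 0 < √(w j) := Real.sqrt_pos.mpr (hpos j)
  have hb1 : √(w j) < 1 := by
    rw [Real.sqrt_lt' one_pos]; simpa using hlt j
  have hwb : w j = √(w j) ^ 2 := (Real.sq_sqrt (hpos j).le).symm
  have h2t : 2 / (t : ℝ) = 2 * (1 / √(t : ℝ)) ^ 2 := by rw [hss]; ring
  rw [undrawnStability, h2t]
  set s := 1 / √(t : ℝ)
  rw [hwb, Real.sqrt_sq hb.le]
  generalize √(w j) = b at *
  have hsb : 0 < 1 - s * b := by nlinarith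
  have h5 : s * b ^ 3 / (1 - s * b) = s * b ^ 3 + s ^ 2 * b ^ 4 / (1 - s * b) := by
    field_simp; ring
  have h6 : (1 - b ^ 2) * (s ^ 2 * b ^ 4 / (1 - s * b)) ≤ 2 * s ^ 2 * b ^ 2 := by
    rw [mul_div_assoc', div_le_iff₀ hsb]
    have h7 : (1 - b ^ 2) ≤ 2 * (1 - s * b) := by nlinarith
    have h8 : b ^ 4 ≤ b ^ 2 := pow_le_pow_of_le_one hb.le hb1.le (by norm_num)
    have h9 : 0 ≤ 1 - b ^ 2 := by nlinarith
    calc (1 - b ^ 2) * (s ^ 2 * b ^ 4) ≤ (2 * (1 - s * b)) * (s ^ 2 * b ^ 2) := by gcongr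
      _ = _ := by ring
  rw [h5]
  nlinarith

/-! ### Sums of powers of `1/√t` -/

theorem one_div_sqrt_succ_le (t : ℕ) :
    1 / √((t + 1 : ℕ) : ℝ) ≤ 2 * (√((t + 1 : ℕ) : ℝ) - √(t : ℝ)) := by
  have hy : 0 < √((t + 1 : ℕ) : ℝ) := Real.sqrt_pos.mpr (by positivity)
  have hx2 : √(t : ℝ) ^ 2 = t := Real.sq_sqrt (by positivity)
  have hy2 : √((t + 1 : ℕ) : ℝ) ^ 2 = (t + 1 : ℕ) := Real.sq_sqrt (by positivity)
  push_cast at *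
  rw [div_le_iff₀ hy]
  nlinarith [sq_nonneg (√((t : ℝ) + 1) - √(t : ℝ))]

theorem two_mul_sqrt_sub_le {m : ℕ} (hm : 0 < m) :
    2 * (√((m + 1 : ℕ) : ℝ) - √(m : ℝ)) ≤ 1 / √(m : ℝ) := by
  have hx : 0 < √(m : ℝ) := Real.sqrt_pos.mpr (by positivity)
  have hx2 : √(m : ℝ) ^ 2 = m := Real.sq_sqrt (by positivity)
  have hy2 : √((m + 1 : ℕ) : ℝ) ^ 2 = (m + 1 : ℕ) := Real.sq_sqrt (by positivity)
  push_cast at *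
  rw [le_div_iff₀ hx]
  nlinarith [sq_nonneg (√((m : ℝ) + 1) - √(m : ℝ))]

theorem one_div_sqrt_succ_pow_three_le {t : ℕ} (ht : 0 < t) :
    1 / √((t + 1 : ℕ) : ℝ) ^ 3 ≤ 2 / √(t : ℝ) - 2 / √((t + 1 : ℕ) : ℝ) := by
  have hx : 0 < √(t : ℝ) := Real.sqrt_pos.mpr (by positivity)
  have h1 := one_div_sqrt_succ_le t
  have hy : 0 < √((t + 1 : ℕ) : ℝ) := Real.sqrt_pos.mpr (by positivity)
  have hxy : √(t : ℝ) ≤ √((t + 1 : ℕ) : ℝ) := Real.sqrt_le_sqrt (by push_cast; linarith)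
  generalize √((t + 1 : ℕ) : ℝ) = y at *
  generalize √(t : ℝ) = x at *
  calc 1 / y ^ 3 = (1 / y) * (1 / (y * y)) := by field_simp
    _ ≤ (2 * (y - x)) * (1 / (x * y)) := by
      have : 0 ≤ 2 * (y - x) := by linarith
      gcongr
    _ = 2 / x - 2 / y := by field_simp

theorem sum_one_div_sqrt_ge (T : ℕ) :
    2 * √((T + 1 : ℕ) : ℝ) - 2 ≤ ∑ t ∈ Finset.Icc 1 T, 1 / √(t : ℝ) := by
  induction T with
  | zero => simp
  | succ n ih =>
    rw [Finset.sum_Icc_succ_top (by omega)]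
    have := two_mul_sqrt_sub_le (Nat.succ_pos n)
    simp only [Nat.succ_eq_add_one] at this
    linarith

theorem sum_inv_sqrt_split_le {A B : ℝ} (hA : 0 ≤ A) (hB : 0 ≤ B) {n : ℕ} (hn : 0 < n) (T : ℕ) :
    ∑ t ∈ Finset.Icc 1 T, (if t ≤ n then A * (1 / √(t : ℝ)) else B * (1 / √(t : ℝ) ^ 3)) ≤
      2 * A * √(n : ℝ) + 2 * B / √(n : ℝ) := by
  have hsn : 0 < √(n : ℝ) := Real.sqrt_pos.mpr (by positivity)
  have main : ∑ t ∈ Finset.Icc 1 T, (if t ≤ n then A * (1 / √(t : ℝ)) else B * (1 / √(t : ℝ) ^ 3)) ≤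
      -- An invariant with two regimes: the first sum telescopes through `√t` and the second through
      -- `-2/√t`, glued together at `n`.
      if T ≤ n then 2 * A * √(T : ℝ)
        else 2 * A * √(n : ℝ) + B * (2 / √(n : ℝ)) - B * (2 / √(T : ℝ)) := by
    induction T with
    | zero => simp
    | succ m ih =>
      rw [Finset.sum_Icc_succ_top (by omega)]
      rcases lt_trichotomy m n with h | h | h
      · rw [if_pos h.le] at ih
        rw [if_pos (show m + 1 ≤ n by omega), if_pos (show m + 1 ≤ n by omega)]
        have := mul_le_mul_of_nonneg_left (one_div_sqrt_succ_le m) hA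
        linarith
      · subst h
        rw [if_pos le_rfl] at ih
        rw [if_neg (by omega), if_neg (by omega)]
        have := mul_le_mul_of_nonneg_left (one_div_sqrt_succ_pow_three_le hn) hB
        linarith
      · rw [if_neg (by omega)] at ih
        rw [if_neg (by omega), if_neg (by omega)]
        have := mul_le_mul_of_nonneg_left (one_div_sqrt_succ_pow_three_le (hn.trans h)) hB
        linarith
  refine main.trans ?_
  split_ifs with h
  · have h1 : √(T : ℝ) ≤ √(n : ℝ) := Real.sqrt_le_sqrt (by exact_mod_cast h)
    have h2 : 0 ≤ 2 * B / √(n : ℝ) := by positivity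
    nlinarith
  · have h2 : 0 ≤ B * (2 / √(T : ℝ)) := by positivity
    have h3 : B * (2 / √(n : ℝ)) = 2 * B / √(n : ℝ) := by ring
    linarith

theorem sum_inv_le_one_add_log (T : ℕ) :
    ∑ t ∈ Finset.Icc 1 T, 1 / (t : ℝ) ≤ 1 + Real.log T := by
  have := harmonic_le_one_add_log T
  simpa [harmonic_eq_sum_Icc] using this

/-! ### The self-bounding inequality, arm by arm -/

/-- Completing the square handles `4 s v - d v ^ 2`; the constant `1/27` is the maximum of `v ^ 2 -
2 v ^ 3` over `v ≥ 0`, attained at `1/3`. -/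
theorem arm_excess_le {s v d : ℝ} (hs : 0 ≤ s) (hv : 0 ≤ v) (hd : 0 < d) :
    4 * s * v + s * (v ^ 2 - 2 * v ^ 3) - d * v ^ 2 ≤ 4 * (s ^ 2 / d) + 1 / 27 * s := by
  have h1 : 4 * (s ^ 2 / d) - 4 * s * v + d * v ^ 2 = d * (v - 2 * (s / d)) ^ 2 := by
    field_simp; ring
  have h2 : 0 ≤ d * (v - 2 * (s / d)) ^ 2 := by positivity
  have h3 : 0 ≤ 1 / 27 - (v ^ 2 - 2 * v ^ 3) := by
    have : 0 ≤ 2 * (v - 1 / 3) ^ 2 * (v + 1 / 6) := by positivity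
    nlinarith
  nlinarith [mul_nonneg hs h3]

/-- For late rounds an error of order `s` would not be summable. Once `s` is small against `d`, the
maximizer lies near `v = 2 s / d`, where `s v ^ 2` has order `s ^ 3 / d ^ 2`, which is summable. -/
theorem arm_excess_le_of_small {s v d : ℝ} (hs : 0 ≤ s) (hv : 0 ≤ v) (hd : 0 < d)
    (hsd : 4 * s ≤ d) :
    4 * s * v + s * (v ^ 2 - 2 * v ^ 3) - d * v ^ 2 ≤ 4 * (s ^ 2 / d) + 8 / d ^ 2 * s ^ 3 := by
  obtain ⟨z, rfl⟩ : ∃ z, s = z * d := ⟨s / d, by field_simp⟩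
  have hz : 0 ≤ z := nonneg_of_mul_nonneg_left hs hd
  have hz4 : 4 * z ≤ 1 := by nlinarith
  have h1 : (z * d) ^ 2 / d = z ^ 2 * d := by field_simp
  have h2 : 8 / d ^ 2 * (z * d) ^ 3 = 8 * z ^ 3 * d := by field_simp
  rw [h1, h2]
  have h3 : 0 ≤ z * v ^ 3 := by positivity
  have h4 : 4 * z * v + z * (v ^ 2 - 2 * v ^ 3) - v ^ 2 ≤ 4 * z ^ 2 + 8 * z ^ 3 := by
    nlinarith [mul_nonneg hz (sq_nonneg (v - 4 * z)), sq_nonneg (v - 2 * z),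
      mul_nonneg (sub_nonneg.mpr hz4) (sq_nonneg (v - 2 * z))]
  nlinarith [mul_le_mul_of_nonneg_right h4 hd.le]

/-- The bound on the expected regret of round `t` when the arm is drawn from `w`. -/
noncomputable def roundBound {K : ℕ} (t : ℕ) (w : Fin K → ℝ) : ℝ :=
  2 * (√(t : ℝ) - √((t - 1 : ℕ) : ℝ)) * (∑ j, √(w j) - 1)
    + (1 / √(t : ℝ) * ∑ j, √(w j) * (1 - w j) + 2 / t)

/-- Arm `c` is eliminated through `√w_c ≤ (1 + w_c) / 2` in the penalty and `√w_c (1 - w_c) ≤ 1 -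
w_c` in the stability, since `1 - w_c` is the total weight of the other arms. The last summand pays
for replacing the penalty coefficient by `1/√t`. -/
theorem two_mul_roundBound_le {K : ℕ} {t : ℕ} (ht : 1 ≤ t) (c : Fin K) {w : Fin K → ℝ}
    (hw : w ∈ stdSimplex ℝ (Fin K)) :
    2 * roundBound t w ≤
      ∑ k ∈ Finset.univ.erase c,
        (4 * (1 / √(t : ℝ)) * √(w k) + 1 / √(t : ℝ) * (√(w k) ^ 2 - 2 * √(w k) ^ 3)
          + 2 * (2 * (√(t : ℝ) - √((t - 1 : ℕ) : ℝ)) - 1 / √(t : ℝ))) + 4 * (1 / (t : ℝ)) := by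
  have hs : 0 < 1 / √(t : ℝ) := by
    have : (0 : ℝ) < t := by exact_mod_cast ht
    positivity
  have hpen : 1 / √(t : ℝ) ≤ 2 * (√(t : ℝ) - √((t - 1 : ℕ) : ℝ)) := by
    obtain ⟨m, rfl⟩ : ∃ m, t = m + 1 := ⟨t - 1, by omega⟩
    exact one_div_sqrt_succ_le m
  rw [roundBound]
  generalize 1 / √(t : ℝ) = s at *
  generalize 2 * (√(t : ℝ) - √((t - 1 : ℕ) : ℝ)) = q at *
  have hsum := hw.2
  rw [← Finset.add_sum_erase _ _ (Finset.mem_univ c)] at hsum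
  have hle1 : ∀ k, w k ≤ 1 := fun k => by
    rw [← hw.2]; exact Finset.single_le_sum (fun i _ => hw.1 i) (Finset.mem_univ k)
  have hv0 := Real.sqrt_nonneg (w c)
  have hv1 : √(w c) ≤ 1 := Real.sqrt_le_one.mpr (hle1 c)
  have hv2 := Real.sq_sqrt (hw.1 c)
  have h1 : ∑ j, √(w j) - 1 ≤ ∑ k ∈ Finset.univ.erase c, (√(w k) - w k / 2) := by
    rw [← Finset.add_sum_erase _ _ (Finset.mem_univ c), Finset.sum_sub_distrib, ← Finset.sum_div]
    nlinarith
  have h2 : ∑ j, √(w j) * (1 - w j) ≤ ∑ k ∈ Finset.univ.erase c, (√(w k) * (1 - w k) + w k) := by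
    rw [← Finset.add_sum_erase _ _ (Finset.mem_univ c), Finset.sum_add_distrib]
    nlinarith [hle1 c]
  have h3 := mul_le_mul_of_nonneg_left h1 (hs.le.trans hpen)
  have h4 := mul_le_mul_of_nonneg_left h2 hs.le
  have h5 : 2 * (q * ∑ k ∈ Finset.univ.erase c, (√(w k) - w k / 2)
      + s * ∑ k ∈ Finset.univ.erase c, (√(w k) * (1 - w k) + w k)) ≤
      ∑ k ∈ Finset.univ.erase c, (4 * s * √(w k) + s * (√(w k) ^ 2 - 2 * √(w k) ^ 3)
        + 2 * (q - s)) := by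
    rw [Finset.mul_sum, Finset.mul_sum, ← Finset.sum_add_distrib, Finset.mul_sum]
    refine Finset.sum_le_sum fun k _ => ?_
    have hk0 := Real.sqrt_nonneg (w k)
    have hk1 : √(w k) ≤ 1 := Real.sqrt_le_one.mpr (hle1 k)
    have hk2 := Real.sq_sqrt (hw.1 k)
    generalize √(w k) = v at *
    rw [← hk2]
    nlinarith [mul_le_mul_of_nonneg_left hk1 (sub_nonneg.mpr hpen),
      mul_nonneg (sub_nonneg.mpr hpen) (sq_nonneg v)]
  have h6 : 2 / (t : ℝ) = 2 * (1 / (t : ℝ)) := by ring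
  rw [h6]
  linarith

theorem sum_arm_le {d : ℝ} (hd : 0 < d) (hd2 : d ≤ 1 / 2) (v : ℕ → ℝ) (hv : ∀ t, 1 ≤ t → 0 ≤ v t)
    (T : ℕ) :
    ∑ t ∈ Finset.Icc 1 T, (4 * (1 / √(t : ℝ)) * v t + 1 / √(t : ℝ) * (v t ^ 2 - 2 * v t ^ 3)
      + 2 * (2 * (√(t : ℝ) - √((t - 1 : ℕ) : ℝ)) - 1 / √(t : ℝ)) - d * v t ^ 2) ≤
      (4 * Real.log T + 12) / d := by
  -- Beyond this threshold `4 / √t ≤ d`, so the late-round estimate applies; up to it, the early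
  -- errors sum to order `√n`, that is `1 / d`.
  set n := ⌈16 / d ^ 2⌉₊ with hn
  have hn0 : 0 < n := Nat.ceil_pos.mpr (by positivity)
  have hnge : 16 / d ^ 2 ≤ n := Nat.le_ceil _
  have hsqrt : ∀ x : ℝ, 16 / d ^ 2 ≤ x → 4 / d ≤ √x := fun x hx => by
    refine Real.le_sqrt_of_sq_le (le_trans (le_of_eq ?_) hx)
    rw [div_pow]; norm_num
  have hnle : √(n : ℝ) ≤ 5 / d := by
    rw [Real.sqrt_le_left (by positivity)]
    have h1 : (n : ℝ) < 16 / d ^ 2 + 1 := Nat.ceil_lt_add_one (by positivity)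
    have h2 : (5 / d) ^ 2 = 16 / d ^ 2 + 9 / d ^ 2 := by rw [div_pow]; ring
    have h3 : 1 ≤ 9 / d ^ 2 := by rw [le_div_iff₀ (by positivity)]; nlinarith
    linarith
  have hround : ∀ t ∈ Finset.Icc 1 T,
      4 * (1 / √(t : ℝ)) * v t + 1 / √(t : ℝ) * (v t ^ 2 - 2 * v t ^ 3)
        + 2 * (2 * (√(t : ℝ) - √((t - 1 : ℕ) : ℝ)) - 1 / √(t : ℝ)) - d * v t ^ 2 ≤
      4 / d * (1 / (t : ℝ))
        + (if t ≤ n then 1 / 27 * (1 / √(t : ℝ)) else 8 / d ^ 2 * (1 / √(t : ℝ) ^ 3))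
        + 2 * (2 * (√(t : ℝ) - √((t - 1 : ℕ) : ℝ)) - 1 / √(t : ℝ)) := by
    intro t ht
    have ht1 := (Finset.mem_Icc.mp ht).1
    have htpos : (0 : ℝ) < t := by exact_mod_cast ht1
    have hs : 0 ≤ 1 / √(t : ℝ) := by positivity
    have hs2 : 4 * ((1 / √(t : ℝ)) ^ 2 / d) = 4 / d * (1 / (t : ℝ)) := by
      rw [div_pow, one_pow, Real.sq_sqrt htpos.le]; ring
    split_ifs with h
    · have := arm_excess_le hs (hv t ht1) hd
      linarith
    · have h4 : 4 / d ≤ √(t : ℝ) := hsqrt t (hnge.trans (by exact_mod_cast (not_le.mp h).le))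
      have h5 : 4 * (1 / √(t : ℝ)) ≤ d := by
        rw [div_le_iff₀ hd] at h4
        rw [mul_one_div, div_le_iff₀ (by positivity)]
        linarith
      have := arm_excess_le_of_small hs (hv t ht1) hd h5
      rw [div_pow, one_pow] at this
      rw [div_pow 1 _ 3, one_pow] at this
      rw [← hs2, div_pow, one_pow]
      linarith
  refine (Finset.sum_le_sum hround).trans ?_
  rw [Finset.sum_add_distrib, Finset.sum_add_distrib, ← Finset.mul_sum, ← Finset.mul_sum,
    Finset.sum_sub_distrib]
  have h1 := mul_le_mul_of_nonneg_left (sum_inv_le_one_add_log T) (by positivity : 0 ≤ 4 / d)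
  have h2 := sum_inv_sqrt_split_le (by norm_num : (0 : ℝ) ≤ 1 / 27)
    (by positivity : 0 ≤ 8 / d ^ 2) hn0 T
  have h3 := sum_one_div_sqrt_ge T
  have h4 : ∑ t ∈ Finset.Icc 1 T, 2 * (√(t : ℝ) - √((t - 1 : ℕ) : ℝ)) = 2 * √(T : ℝ) := by
    clear * -
    induction T with
    | zero => simp
    | succ m ih => rw [Finset.sum_Icc_succ_top (by omega), ih]; simp; ring
  have h5 : √(T : ℝ) ≤ √((T + 1 : ℕ) : ℝ) := Real.sqrt_le_sqrt (by push_cast; linarith)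
  have h6 : 2 * (8 / d ^ 2) / √(n : ℝ) ≤ 4 / d := by
    have := hsqrt n hnge
    rw [div_le_iff₀ (lt_of_lt_of_le (by positivity) this)]
    calc 2 * (8 / d ^ 2) = 4 / d * (4 / d) := by field_simp; norm_num
      _ ≤ _ := by gcongr
  -- Replacing the penalty coefficients costs at most 4 over all rounds, absorbed into `2 / d` by `d
  -- ≤ 1/2`. The constants multiplying `1 / d` are then `4`, `10/27`, `4` and `2`, below `12`.
  have h7 : 4 ≤ 2 * (1 / d) := by
    rw [mul_one_div, le_div_iff₀ hd]; linarith
  have h8 : (4 * Real.log T + 12) / d = 4 / d * (1 + Real.log T) + 8 * (1 / d) := by ring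
  have h9 : 5 / d = 5 * (1 / d) := by ring
  have h10 : 4 / d = 4 * (1 / d) := by ring
  rw [h8]
  rw [h9] at hnle
  rw [h10] at h6
  linarith

/-- The self-bounding inequality: the doubled regret bound minus the regret is logarithmic. -/
theorem self_bounding {K : ℕ} (c : Fin K) (d : Fin K → ℝ) (hd : ∀ k, k ≠ c → 0 < d k)
    (hd2 : ∀ k, d k ≤ 1 / 2) (p : ℕ → Fin K → ℝ)
    (hp : ∀ t, 1 ≤ t → p t ∈ stdSimplex ℝ (Fin K)) (T : ℕ) :
    ∑ t ∈ Finset.Icc 1 T, (2 * roundBound t (p t) - ∑ k ∈ Finset.univ.erase c, d k * p t k) ≤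
      ∑ k ∈ Finset.univ.erase c, (4 * Real.log T + 12) / d k + 4 * Real.log T + 4 := by
  have h1 : ∀ t ∈ Finset.Icc 1 T,
      2 * roundBound t (p t) - ∑ k ∈ Finset.univ.erase c, d k * p t k ≤
      ∑ k ∈ Finset.univ.erase c,
        (4 * (1 / √(t : ℝ)) * √(p t k) + 1 / √(t : ℝ) * (√(p t k) ^ 2 - 2 * √(p t k) ^ 3)
          + 2 * (2 * (√(t : ℝ) - √((t - 1 : ℕ) : ℝ)) - 1 / √(t : ℝ)) - d k * √(p t k) ^ 2)
        + 4 * (1 / (t : ℝ)) := by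
    intro t ht
    have ht1 := (Finset.mem_Icc.mp ht).1
    have h := two_mul_roundBound_le ht1 c (hp t ht1)
    have h' : ∑ k ∈ Finset.univ.erase c, d k * √(p t k) ^ 2
        = ∑ k ∈ Finset.univ.erase c, d k * p t k :=
      Finset.sum_congr rfl fun k _ => by rw [Real.sq_sqrt ((hp t ht1).1 k)]
    rw [Finset.sum_sub_distrib, h']
    linarith
  refine (Finset.sum_le_sum h1).trans ?_
  rw [Finset.sum_add_distrib, Finset.sum_comm, ← Finset.mul_sum]
  have h2 := sum_inv_le_one_add_log T
  have h3 := Finset.sum_le_sum fun k (hk : k ∈ Finset.univ.erase c) =>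
    sum_arm_le (hd k (Finset.ne_of_mem_erase hk)) (hd2 k) (fun t => √(p t k))
      (fun t _ => Real.sqrt_nonneg _) T
  linarith

/-! ### Measurability and conditional expectations along the run -/

/-- Directional derivatives given by `fderiv` are measurable, so no continuity of the maximizer in
the losses is needed. -/
theorem measurable_weights {K : ℕ} (t : ℕ) (k : Fin K) :
    Measurable fun L : Fin K → ℝ => weights t L k :=
  (measurable_fderiv_apply_const ℝ (conjugate t) (Pi.single k 1)).comp measurable_neg

theorem measurable_comp_arms {Ω : Type*} {m : MeasurableSpace Ω} {K : ℕ}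
    {f : Fin K → Fin K → Ω → ℝ} (hf : ∀ a b, Measurable (f a b)) {A B : Ω → Fin K}
    (hA : Measurable A) (hB : Measurable B) : Measurable fun ω => f (A ω) (B ω) ω := by
  have : (fun ω => f (A ω) (B ω) ω) =
      fun ω => ∑ a, ∑ b, if A ω = a ∧ B ω = b then f a b ω else 0 := by
    funext ω
    simp [ite_and]
  rw [this]
  refine Finset.measurable_sum _ fun a _ => Finset.measurable_sum _ fun b _ => ?_
  refine Measurable.ite ?_ (hf a b) measurable_const
  exact (hA (measurableSet_singleton a)).inter (hB (measurableSet_singleton b))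

theorem integrable_of_measurable_of_abs_le {Ω : Type*} {mΩ : MeasurableSpace Ω} {μ : Measure Ω}
    [IsFiniteMeasure μ] {f : Ω → ℝ} (hf : Measurable f) {M : ℝ} (hM : ∀ ω, |f ω| ≤ M) :
    Integrable f μ :=
  Integrable.of_bound hf.aestronglyMeasurable M (ae_of_all _ hM)

theorem integral_mul_eq_of_condExp {Ω : Type*} {m mΩ : MeasurableSpace Ω} {μ : Measure Ω}
    [IsFiniteMeasure μ] (hm : m ≤ mΩ) {f g h : Ω → ℝ} (hf : Measurable[m] f) {M : ℝ}
    (hM : ∀ ω, |f ω| ≤ M) (hg : Integrable g μ) (hgh : μ[g | m] =ᵐ[μ] h) :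
    ∫ ω, f ω * g ω ∂μ = ∫ ω, f ω * h ω ∂μ := by
  rw [← integral_condExp hm]
  refine integral_congr_ae ?_
  filter_upwards [condExp_stronglyMeasurable_mul_of_bound hm hf.stronglyMeasurable hg M
    (ae_of_all _ hM), hgh] with ω h1 h2
  refine Eq.trans h1 ?_
  rw [Pi.mul_apply, h2]

namespace IsCorruptedRun

variable {Ω : Type*} {mΩ : MeasurableSpace Ω} {K : ℕ} {μ : Measure Ω}
  {P : Matrix (Fin K) (Fin K) ℝ} {F : Filtration ℕ mΩ} {G : ℕ → MeasurableSpace Ω}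
  {o x : ℕ → Ω → Matrix (Fin K) (Fin K) ℝ} {arm : ℤˣ → ℕ → Ω → Fin K}

theorem G_le_space (hrun : IsCorruptedRun μ P F G o x arm) {t : ℕ} (ht : 1 ≤ t) : G t ≤ mΩ :=
  (hrun.G_le t ht).trans (F.le t)

theorem measurable_observed (hrun : IsCorruptedRun μ P F G o x arm) {t : ℕ} (ht : 1 ≤ t) (i : ℤˣ) :
    Measurable[F t] fun ω => x t ω (arm (-i) t ω) (arm i t ω) :=
  measurable_comp_arms (m := F t) (f := fun a b ω => x t ω a b)
    (fun a b => (hrun.measurable_x t ht a b).mono (hrun.G_le t ht) le_rfl)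
    (hrun.measurable_arm t ht (-i)) (hrun.measurable_arm t ht i)

theorem measurable_cumLoss (hrun : IsCorruptedRun μ P F G o x arm) (i : ℤˣ) (t : ℕ) :
    Measurable[F t] fun ω =>
      cumLoss (fun s => arm i s ω) (fun s => x s ω (arm (-i) s ω) (arm i s ω)) t := by
  induction t with
  | zero => exact measurable_const
  | succ n ih =>
    have ih' := ih.mono (F.mono n.le_succ) le_rfl
    refine @measurable_pi_lambda _ _ _ (F (n + 1)) _ _ fun k => ?_
    refine Measurable.add (m := F (n + 1)) ((measurable_pi_apply k).comp ih') ?_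
    simp only [lossEstimate]
    refine Measurable.ite ?_ ?_ ?_
    · have h := hrun.measurable_arm (n + 1) (by omega) i (measurableSet_singleton k)
      convert h using 1
      ext ω
      simp [eq_comm]
    · exact (hrun.measurable_observed (by omega) i).div ((measurable_weights (n + 1) k).comp ih')
    · exact measurable_const

theorem measurable_playDist (hrun : IsCorruptedRun μ P F G o x arm) (i : ℤˣ) (t : ℕ) (k : Fin K) :
    Measurable[F (t - 1)] fun ω => playDist arm x i t ω k :=
  (measurable_weights t k).comp (hrun.measurable_cumLoss i (t - 1))

theorem measurable_playDist_G (hrun : IsCorruptedRun μ P F G o x arm) (i : ℤˣ) {t : ℕ}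
    (ht : 1 ≤ t) (k : Fin K) : Measurable[G t] fun ω => playDist arm x i t ω k :=
  (hrun.measurable_playDist i t k).mono (hrun.le_G t ht) le_rfl

theorem measurable_playDist_space (hrun : IsCorruptedRun μ P F G o x arm) (i : ℤˣ) (t : ℕ)
    (k : Fin K) : Measurable fun ω => playDist arm x i t ω k :=
  (hrun.measurable_playDist i t k).mono (F.le _) le_rfl

theorem abs_o_le_one (hrun : IsCorruptedRun μ P F G o x arm) {t : ℕ} (ht : 1 ≤ t) (ω : Ω)
    (k k' : Fin K) : |o t ω k k'| ≤ 1 := by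
  by_cases h : k = k'
  · subst h
    have h1 := hrun.o_swap t ht ω k k
    have : o t ω k k = 1 / 2 := by linarith
    rw [this]
    norm_num [abs_le]
  · rcases hrun.o_binary t ht ω k k' h with h1 | h1 <;> rw [h1] <;> norm_num

theorem abs_x_le_one (hrun : IsCorruptedRun μ P F G o x arm) {t : ℕ} (ht : 1 ≤ t) (ω : Ω)
    (k k' : Fin K) : |x t ω k k'| ≤ 1 := by
  have h := hrun.x_mem_Icc t ht ω k k'
  rw [abs_of_nonneg h.1]
  exact h.2

theorem measurable_o_space (hrun : IsCorruptedRun μ P F G o x arm) {t : ℕ} (ht : 1 ≤ t)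
    (k k' : Fin K) : Measurable fun ω => o t ω k k' :=
  (hrun.measurable_o t ht k k').mono (hrun.G_le_space ht) le_rfl

theorem measurable_x_space (hrun : IsCorruptedRun μ P F G o x arm) {t : ℕ} (ht : 1 ≤ t)
    (k k' : Fin K) : Measurable fun ω => x t ω k k' :=
  (hrun.measurable_x t ht k k').mono (hrun.G_le_space ht) le_rfl

theorem integrable_corruption_round [IsProbabilityMeasure μ]
    (hrun : IsCorruptedRun μ P F G o x arm) {t : ℕ} (ht : 1 ≤ t) (k : Fin K) :
    Integrable (fun ω => ∑ k' ∈ Finset.univ.erase k, |o t ω k k' - x t ω k k'|) μ :=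
  integrable_finsetSum _ fun k' _ =>
    ((integrable_of_measurable_of_abs_le (hrun.measurable_o_space ht k k')
      fun ω => hrun.abs_o_le_one ht ω k k').sub
    (integrable_of_measurable_of_abs_le (hrun.measurable_x_space ht k k')
      fun ω => hrun.abs_x_le_one ht ω k k')).abs

theorem measurable_lossEstimate (hrun : IsCorruptedRun μ P F G o x arm) {t : ℕ} (ht : 1 ≤ t)
    (i : ℤˣ) (k a b : Fin K) :
    Measurable[G t] fun ω => lossEstimate (playDist arm x i t ω) a (x t ω b a) k := by
  simp only [lossEstimate]
  by_cases h : k = a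
  · simp only [h, if_true]
    exact (hrun.measurable_x t ht b a).div (hrun.measurable_playDist_G i ht a)
  · simp only [h, if_false]
    exact measurable_const

theorem integrable_observed [IsProbabilityMeasure μ] (hrun : IsCorruptedRun μ P F G o x arm)
    {t : ℕ} (ht : 1 ≤ t) (i : ℤˣ) :
    Integrable (fun ω => x t ω (arm (-i) t ω) (arm i t ω)) μ :=
  integrable_of_measurable_of_abs_le ((hrun.measurable_observed ht i).mono (F.le t) le_rfl)
    fun ω => hrun.abs_x_le_one ht ω _ _

variable [NeZero K]

theorem playDist_mem (i : ℤˣ) {t : ℕ} (ht : 1 ≤ t) (ω : Ω) :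
    playDist arm x i t ω ∈ stdSimplex ℝ (Fin K) :=
  (weights_spec ht _).1

theorem playDist_pos (i : ℤˣ) {t : ℕ} (ht : 1 ≤ t) (ω : Ω) (k : Fin K) :
    0 < playDist arm x i t ω k :=
  weights_pos ht _ k

theorem playDist_le_one (i : ℤˣ) {t : ℕ} (ht : 1 ≤ t) (ω : Ω) (k : Fin K) :
    playDist arm x i t ω k ≤ 1 := by
  have h := playDist_mem (arm := arm) (x := x) i ht ω
  rw [← h.2]
  exact Finset.single_le_sum (fun j _ => h.1 j) (Finset.mem_univ k)

theorem abs_playDist_le_one (i : ℤˣ) {t : ℕ} (ht : 1 ≤ t) (ω : Ω) (k : Fin K) :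
    |playDist arm x i t ω k| ≤ 1 := by
  rw [abs_of_nonneg (playDist_pos i ht ω k).le]
  exact playDist_le_one i ht ω k

-- Bounded cumulative losses keep the weights away from 0, which bounds the next importance-weighted
-- estimate. These crude deterministic bounds serve only integrability.
theorem exists_cumLoss_le (hrun : IsCorruptedRun μ P F G o x arm) (i : ℤˣ) (t : ℕ) :
    ∃ M, ∀ ω k,
      0 ≤ cumLoss (fun s => arm i s ω) (fun s => x s ω (arm (-i) s ω) (arm i s ω)) t k ∧
      cumLoss (fun s => arm i s ω) (fun s => x s ω (arm (-i) s ω) (arm i s ω)) t k ≤ M := by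
  induction t with
  | zero => exact ⟨0, fun ω k => by simp [cumLoss]⟩
  | succ n ih =>
    obtain ⟨M, hM⟩ := ih
    refine ⟨M + (√(K : ℝ) + M / √((n + 1 : ℕ) : ℝ)) ^ 2, fun ω k => ?_⟩
    have hge := weights_ge (Nat.succ_pos n) (fun k => (hM ω k).1) (fun k => (hM ω k).2) k
    have hpos := weights_pos (Nat.succ_pos n)
      (cumLoss (fun s => arm i s ω) (fun s => x s ω (arm (-i) s ω) (arm i s ω)) n) k
    have hx := hrun.x_mem_Icc (n + 1) (by omega) ω (arm (-i) (n + 1) ω) (arm i (n + 1) ω)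
    simp only [cumLoss, Pi.add_apply, lossEstimate]
    simp only [Nat.succ_eq_add_one] at hge hpos
    have hM0 : 0 ≤ M := (hM ω k).1.trans (hM ω k).2
    have hKpos : 0 < √(K : ℝ) :=
      Real.sqrt_pos.mpr (by exact_mod_cast Nat.pos_of_ne_zero (NeZero.ne K))
    split_ifs
    · refine ⟨add_nonneg (hM ω k).1 (div_nonneg hx.1 hpos.le), add_le_add (hM ω k).2 ?_⟩
      rw [div_le_iff₀ hpos]
      refine hx.2.trans ?_
      have hB : 0 < (√(K : ℝ) + M / √((n + 1 : ℕ) : ℝ)) ^ 2 := by positivity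
      have := mul_le_mul_of_nonneg_left hge hB.le
      rwa [mul_inv_cancel₀ hB.ne'] at this
    · have := hM ω k
      refine ⟨by linarith, add_le_add this.2 (by positivity)⟩

theorem exists_le_playDist (hrun : IsCorruptedRun μ P F G o x arm) (i : ℤˣ) {t : ℕ} (ht : 1 ≤ t) :
    ∃ c, 0 < c ∧ ∀ ω k, c ≤ playDist arm x i t ω k := by
  obtain ⟨M, hM⟩ := hrun.exists_cumLoss_le i (t - 1)
  have hKpos : 0 < √(K : ℝ) :=
    Real.sqrt_pos.mpr (by exact_mod_cast Nat.pos_of_ne_zero (NeZero.ne K))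
  refine ⟨((√(K : ℝ) + |M| / √(t : ℝ)) ^ 2)⁻¹, by positivity, fun ω k => ?_⟩
  exact weights_ge ht (fun k => (hM ω k).1) (fun k => (hM ω k).2.trans (le_abs_self M)) k

/-! ### Expectations within one round -/

/-- The two arms of a round are drawn independently from the two sampling distributions. -/
theorem integral_arms [IsProbabilityMeasure μ] (hrun : IsCorruptedRun μ P F G o x arm) {t : ℕ}
    (ht : 1 ≤ t) (i : ℤˣ) {f : Fin K → Fin K → Ω → ℝ} (hf : ∀ a b, Measurable[G t] (f a b))
    {M : ℝ} (hM : ∀ a b ω, |f a b ω| ≤ M) :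
    ∫ ω, f (arm i t ω) (arm (-i) t ω) ω ∂μ =
      ∫ ω, ∑ a, ∑ b, playDist arm x i t ω a * playDist arm x (-i) t ω b * f a b ω ∂μ := by
  have main : ∀ {f : Fin K → Fin K → Ω → ℝ}, (∀ a b, Measurable[G t] (f a b)) →
      (∀ a b ω, |f a b ω| ≤ M) → ∫ ω, f (arm 1 t ω) (arm (-1) t ω) ω ∂μ =
      ∫ ω, ∑ a, ∑ b, playDist arm x 1 t ω a * playDist arm x (-1) t ω b * f a b ω ∂μ := by
    intro f hf hM
    have hm := hrun.G_le_space ht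
    have hf' : ∀ a b, Measurable (f a b) := fun a b => (hf a b).mono hm le_rfl
    set I : Fin K → Fin K → Ω → ℝ := fun a b =>
      Set.indicator {ω | arm 1 t ω = a ∧ arm (-1) t ω = b} (fun _ => (1 : ℝ)) with hI
    have hIm : ∀ a b, Measurable (I a b) := fun a b => by
      refine measurable_const.indicator ?_
      exact (((hrun.measurable_arm t ht 1).mono (F.le t) le_rfl) (measurableSet_singleton a)).inter
        (((hrun.measurable_arm t ht (-1)).mono (F.le t) le_rfl) (measurableSet_singleton b))
    have hIb : ∀ a b ω, |I a b ω| ≤ 1 := fun a b ω => by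
      simp only [hI, Set.indicator_apply]
      split_ifs <;> simp
    have hIi : ∀ a b, Integrable (I a b) μ := fun a b =>
      integrable_of_measurable_of_abs_le (hIm a b) (hIb a b)
    have hM0 : 0 ≤ M := by
      obtain ⟨ω⟩ := nonempty_of_isProbabilityMeasure μ
      exact (abs_nonneg _).trans (hM 0 0 ω)
    have hfi : ∀ a b, Integrable (fun ω => f a b ω * I a b ω) μ := fun a b =>
      integrable_of_measurable_of_abs_le (M := M) ((hf' a b).mul (hIm a b)) fun ω => by
        rw [abs_mul]
        nlinarith [hM a b ω, hIb a b ω, abs_nonneg (f a b ω), abs_nonneg (I a b ω)]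
    have hpi : ∀ a b, Integrable
        (fun ω => playDist arm x 1 t ω a * playDist arm x (-1) t ω b * f a b ω) μ := fun a b =>
      integrable_of_measurable_of_abs_le (M := 1 * 1 * M)
        (((hrun.measurable_playDist_space 1 t a).mul
          (hrun.measurable_playDist_space (-1) t b)).mul (hf' a b)) fun ω => by
        rw [abs_mul, abs_mul]
        gcongr
        · exact abs_playDist_le_one 1 ht ω a
        · exact abs_playDist_le_one (-1) ht ω b
        · exact hM a b ω
    have h1 : ∀ ω, f (arm 1 t ω) (arm (-1) t ω) ω = ∑ a, ∑ b, f a b ω * I a b ω := by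
      intro ω
      simp [hI, Set.indicator_apply, ite_and]
    simp_rw [h1]
    rw [integral_finsetSum _ fun a _ => integrable_finsetSum _ fun b _ => hfi a b,
      integral_finsetSum _ fun a _ => integrable_finsetSum _ fun b _ => hpi a b]
    refine Finset.sum_congr rfl fun a _ => ?_
    rw [integral_finsetSum _ fun b _ => hfi a b, integral_finsetSum _ fun b _ => hpi a b]
    refine Finset.sum_congr rfl fun b _ => ?_
    rw [integral_mul_eq_of_condExp hm (hf a b) (hM a b) (hIi a b) (hrun.arm_law t ht a b)]
    exact integral_congr_ae (ae_of_all _ fun ω => mul_comm _ _)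
  rcases Int.units_eq_one_or i with rfl | rfl
  · exact main hf hM
  · rw [neg_neg]
    refine (main (f := fun a b => f b a) (fun a b => hf b a) (fun a b => hM b a)).trans ?_
    refine integral_congr_ae (ae_of_all _ fun ω => ?_)
    beta_reduce
    rw [Finset.sum_comm]
    refine Finset.sum_congr rfl fun a _ => Finset.sum_congr rfl fun b _ => ?_
    ring

theorem integral_arm [IsProbabilityMeasure μ] (hrun : IsCorruptedRun μ P F G o x arm) {t : ℕ}
    (ht : 1 ≤ t) (i : ℤˣ) {f : Fin K → Ω → ℝ} (hf : ∀ a, Measurable[G t] (f a))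
    {M : ℝ} (hM : ∀ a ω, |f a ω| ≤ M) :
    ∫ ω, f (arm i t ω) ω ∂μ = ∫ ω, ∑ a, playDist arm x i t ω a * f a ω ∂μ := by
  rw [hrun.integral_arms ht i (f := fun a _ => f a) (fun a _ => hf a) (fun a _ => hM a)]
  refine integral_congr_ae (ae_of_all _ fun ω => Finset.sum_congr rfl fun a _ => ?_)
  rw [← Finset.sum_mul, ← Finset.mul_sum, (playDist_mem (-i) ht ω).2, mul_one]

theorem integrable_playDist_mul [IsProbabilityMeasure μ]
    (hrun : IsCorruptedRun μ P F G o x arm) {t : ℕ} (ht : 1 ≤ t) (i : ℤˣ) {f : Fin K → Ω → ℝ}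
    (hf : ∀ a, Measurable (f a)) {M : ℝ} (hM : ∀ a ω, |f a ω| ≤ M) (a : Fin K) :
    Integrable (fun ω => playDist arm x i t ω a * f a ω) μ :=
  integrable_of_measurable_of_abs_le (M := 1 * M)
    ((hrun.measurable_playDist_space i t a).mul (hf a)) fun ω => by
      rw [abs_mul]
      have := abs_playDist_le_one (arm := arm) (x := x) i ht ω a
      gcongr
      exact hM a ω

/-- The drawn arm beats `k` as often as in the corrupted outcomes, up to the corruption. -/
theorem integral_preference_le [IsProbabilityMeasure μ] (hP : IsPreferenceMatrix P)
    (hrun : IsCorruptedRun μ P F G o x arm) {t : ℕ} (ht : 1 ≤ t) (i : ℤˣ) (k : Fin K) :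
    ∫ ω, P k (arm i t ω) ∂μ ≤
      ∫ ω, ∑ a, playDist arm x i t ω a * x t ω k a ∂μ
        + ∫ ω, ∑ k' ∈ Finset.univ.erase k, |o t ω k k' - x t ω k k'| ∂μ := by
  have hPb : ∀ a, |P k a| ≤ 1 := fun a => by
    rw [abs_of_nonneg (hP.mem_Icc k a).1]; exact (hP.mem_Icc k a).2
  have hPi := hrun.integrable_playDist_mul ht i (f := fun a _ => P k a)
    (fun a => measurable_const) (fun a _ => hPb a)
  have hoi := hrun.integrable_playDist_mul ht i (f := fun a ω => o t ω k a)
    (fun a => hrun.measurable_o_space ht k a) (fun a ω => hrun.abs_o_le_one ht ω k a)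
  have hxi := hrun.integrable_playDist_mul ht i (f := fun a ω => x t ω k a)
    (fun a => hrun.measurable_x_space ht k a) (fun a ω => hrun.abs_x_le_one ht ω k a)
  have h1 : ∫ ω, P k (arm i t ω) ∂μ = ∫ ω, ∑ a, playDist arm x i t ω a * o t ω k a ∂μ := by
    rw [hrun.integral_arm ht i (f := fun a _ => P k a) (fun a => measurable_const)
      (fun a _ => hPb a), integral_finsetSum _ fun a _ => hPi a,
      integral_finsetSum _ fun a _ => hoi a]
    refine Finset.sum_congr rfl fun a _ => ?_
    -- The sampling distribution depends on the past only, so the true outcome may replace its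
    -- conditional mean. The drawn arm has already been averaged out.
    exact (integral_mul_eq_of_condExp (F.le (t - 1)) (hrun.measurable_playDist i t a)
      (fun ω => abs_playDist_le_one i ht ω a)
      (integrable_of_measurable_of_abs_le (hrun.measurable_o_space ht k a)
        fun ω => hrun.abs_o_le_one ht ω k a) (hrun.o_law t ht k a)).symm
  rw [h1, ← integral_add (integrable_finsetSum _ fun a _ => hxi a)
    (hrun.integrable_corruption_round ht k)]
  refine integral_mono (integrable_finsetSum _ fun a _ => hoi a)
    ((integrable_finsetSum _ fun a _ => hxi a).add (hrun.integrable_corruption_round ht k))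
    fun ω => ?_
  beta_reduce
  rw [← sub_le_iff_le_add', ← Finset.sum_sub_distrib,
    ← Finset.add_sum_erase _ _ (Finset.mem_univ k)]
  -- Antisymmetry forces both diagonal entries to be `1/2`, so the duel of `k` with itself
  -- contributes no corruption.
  have hkk : o t ω k k = x t ω k k := by
    linarith [hrun.o_swap t ht ω k k, hrun.x_swap t ht ω k k]
  rw [hkk, sub_self, zero_add]
  refine Finset.sum_le_sum fun a _ => ?_
  rw [← mul_sub]
  have h2 := playDist_le_one (arm := arm) (x := x) i ht ω a
  have h3 := (playDist_pos (arm := arm) (x := x) i ht ω a).le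
  nlinarith [le_abs_self (o t ω k a - x t ω k a), abs_nonneg (o t ω k a - x t ω k a)]

theorem exists_abs_lossEstimate_le (hrun : IsCorruptedRun μ P F G o x arm) {t : ℕ} (ht : 1 ≤ t)
    (i : ℤˣ) (k : Fin K) :
    ∃ M, ∀ a b ω, |lossEstimate (playDist arm x i t ω) a (x t ω b a) k| ≤ M := by
  obtain ⟨c, hc, hcp⟩ := hrun.exists_le_playDist i ht
  refine ⟨1 / c, fun a b ω => ?_⟩
  simp only [lossEstimate]
  split_ifs
  · rw [abs_div, abs_of_pos (playDist_pos i ht ω k)]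
    exact div_le_div₀ zero_le_one (hrun.abs_x_le_one ht ω b a) hc (hcp ω k)
  · rw [abs_zero]; positivity

/-- The loss estimates are unbiased. -/
theorem integral_lossEstimate [IsProbabilityMeasure μ] (hrun : IsCorruptedRun μ P F G o x arm)
    {t : ℕ} (ht : 1 ≤ t) (i : ℤˣ) (k : Fin K) :
    ∫ ω, lossEstimate (playDist arm x i t ω) (arm i t ω) (x t ω (arm (-i) t ω) (arm i t ω)) k ∂μ =
      1 - ∫ ω, ∑ a, playDist arm x (-i) t ω a * x t ω k a ∂μ := by
  obtain ⟨M, hM⟩ := hrun.exists_abs_lossEstimate_le ht i k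
  have hxi := hrun.integrable_playDist_mul ht (-i) (f := fun a ω => x t ω k a)
    (fun a => hrun.measurable_x_space ht k a) (fun a ω => hrun.abs_x_le_one ht ω k a)
  rw [hrun.integral_arms ht i
    (f := fun a b ω => lossEstimate (playDist arm x i t ω) a (x t ω b a) k)
    (fun a b => hrun.measurable_lossEstimate ht i k a b) hM]
  have h1 : (1 : ℝ) = ∫ _ω, (1 : ℝ) ∂μ := by simp
  rw [h1, ← integral_sub (integrable_const _) (integrable_finsetSum _ fun a _ => hxi a)]
  refine integral_congr_ae (ae_of_all _ fun ω => ?_)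
  beta_reduce
  have h2 : ∀ a b, playDist arm x i t ω a * playDist arm x (-i) t ω b *
      lossEstimate (playDist arm x i t ω) a (x t ω b a) k =
      if k = a then playDist arm x (-i) t ω b * (1 - x t ω k b) else 0 := by
    intro a b
    simp only [lossEstimate]
    split_ifs with h
    · subst h
      have := (playDist_pos (arm := arm) (x := x) i ht ω k).ne'
      rw [hrun.x_swap t ht ω b k]
      field_simp
    · rw [mul_zero]
  simp only [h2]
  rw [Finset.sum_comm]
  simp only [Finset.sum_ite_eq, Finset.mem_univ, if_true, mul_sub, mul_one,
    Finset.sum_sub_distrib, (playDist_mem (arm := arm) (x := x) (-i) ht ω).2]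

theorem integrable_lossEstimate [IsProbabilityMeasure μ] (hrun : IsCorruptedRun μ P F G o x arm)
    {t : ℕ} (ht : 1 ≤ t) (i : ℤˣ) (k : Fin K) :
    Integrable (fun ω => lossEstimate (playDist arm x i t ω) (arm i t ω)
      (x t ω (arm (-i) t ω) (arm i t ω)) k) μ := by
  obtain ⟨M, hM⟩ := hrun.exists_abs_lossEstimate_le ht i k
  refine integrable_of_measurable_of_abs_le (M := M) ?_ fun ω => hM _ _ ω
  exact measurable_comp_arms
    (f := fun a b ω => lossEstimate (playDist arm x i t ω) a (x t ω b a) k)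
    (fun a b => (hrun.measurable_lossEstimate ht i k a b).mono (hrun.G_le_space ht) le_rfl)
    ((hrun.measurable_arm t ht i).mono (F.le t) le_rfl)
    ((hrun.measurable_arm t ht (-i)).mono (F.le t) le_rfl)

/-- The regrets of the two players against `k` add up to the corrupted duelling regret. -/
theorem integral_player_regret_add [IsProbabilityMeasure μ]
    (hrun : IsCorruptedRun μ P F G o x arm) {t : ℕ} (ht : 1 ≤ t) (k : Fin K) :
    ∫ ω, (x t ω (arm (-1) t ω) (arm 1 t ω) -
        lossEstimate (playDist arm x 1 t ω) (arm 1 t ω) (x t ω (arm (-1) t ω) (arm 1 t ω)) k) ∂μ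
      + ∫ ω, (x t ω (arm (- -1) t ω) (arm (-1) t ω) -
        lossEstimate (playDist arm x (-1) t ω) (arm (-1) t ω)
          (x t ω (arm (- -1) t ω) (arm (-1) t ω)) k) ∂μ =
      ∫ ω, ∑ a, playDist arm x 1 t ω a * x t ω k a ∂μ
        + ∫ ω, ∑ a, playDist arm x (-1) t ω a * x t ω k a ∂μ - 1 := by
  rw [integral_sub (hrun.integrable_observed ht 1) (hrun.integrable_lossEstimate ht 1 k),
    integral_sub (hrun.integrable_observed ht (-1)) (hrun.integrable_lossEstimate ht (-1) k),
    hrun.integral_lossEstimate ht 1 k, hrun.integral_lossEstimate ht (-1) k]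
  -- The game has constant sum: both players observe the same duel from opposite sides.
  have h1 : ∫ ω, x t ω (arm (-1) t ω) (arm 1 t ω) ∂μ
      + ∫ ω, x t ω (arm (- -1) t ω) (arm (-1) t ω) ∂μ = 1 := by
    rw [← integral_add (hrun.integrable_observed ht 1) (hrun.integrable_observed ht (-1))]
    simp only [neg_neg]
    rw [integral_congr_ae (g := fun _ => (1 : ℝ)) (ae_of_all _ fun ω => by
      beta_reduce
      linarith [hrun.x_swap t ht ω (arm (-1) t ω) (arm 1 t ω)])]
    simp
  rw [neg_neg] at *
  linarith

end IsCorruptedRun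

/-! ### From the pathwise bound to the expected regret -/

theorem measurable_stability {K : ℕ} (t : ℕ) (a : Fin K) :
    Measurable fun w : Fin K → ℝ => stability t w a := by
  unfold stability undrawnStability
  fun_prop

theorem stability_nonneg {K : ℕ} {t : ℕ} (ht : 0 < t) {w : Fin K → ℝ}
    (hlt : ∀ k, w k < 1) (a : Fin K) : 0 ≤ stability t w a := by
  have hs1 := inv_sqrt_natCast_le_one ht
  have hs : 0 ≤ 1 / √(t : ℝ) := by positivity
  refine add_nonneg (by positivity) (Finset.sum_nonneg fun j _ => ?_)
  have h1 : √(w j) ≤ 1 := Real.sqrt_le_one.mpr (hlt j).le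
  have h2 : 0 ≤ 1 - 1 / √(t : ℝ) * √(w j) := by nlinarith [Real.sqrt_nonneg (w j)]
  exact div_nonneg (by positivity) h2

theorem abs_sum_sqrt_mul_le {K : ℕ} {w : Fin K → ℝ} (hw : w ∈ stdSimplex ℝ (Fin K)) :
    |∑ j, √(w j) * (1 - w j)| ≤ K := by
  have hle1 : ∀ k, w k ≤ 1 := fun k => by
    rw [← hw.2]; exact Finset.single_le_sum (fun i _ => hw.1 i) (Finset.mem_univ k)
  refine (Finset.abs_sum_le_sum_abs _ _).trans ?_
  refine (Finset.sum_le_card_nsmul _ _ 1 fun j _ => ?_).trans (by simp)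
  rw [abs_of_nonneg (mul_nonneg (Real.sqrt_nonneg _) (sub_nonneg.mpr (hle1 j)))]
  exact mul_le_one₀ (Real.sqrt_le_one.mpr (hle1 j)) (sub_nonneg.mpr (hle1 j))
    (by linarith [hw.1 j])

theorem abs_sum_sqrt_le {K : ℕ} {w : Fin K → ℝ} (hw : w ∈ stdSimplex ℝ (Fin K)) :
    |∑ j, √(w j)| ≤ K := by
  have hle1 : ∀ k, w k ≤ 1 := fun k => by
    rw [← hw.2]; exact Finset.single_le_sum (fun i _ => hw.1 i) (Finset.mem_univ k)
  rw [abs_of_nonneg (Finset.sum_nonneg fun j _ => Real.sqrt_nonneg _)]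
  exact (Finset.sum_le_card_nsmul _ _ 1 fun j _ => Real.sqrt_le_one.mpr (hle1 j)).trans (by simp)

namespace IsCorruptedRun

variable {Ω : Type*} {mΩ : MeasurableSpace Ω} {K : ℕ} {μ : Measure Ω}
  {P : Matrix (Fin K) (Fin K) ℝ} {F : Filtration ℕ mΩ} {G : ℕ → MeasurableSpace Ω}
  {o x : ℕ → Ω → Matrix (Fin K) (Fin K) ℝ} {arm : ℤˣ → ℕ → Ω → Fin K}

theorem integrable_preference [IsProbabilityMeasure μ] (hP : IsPreferenceMatrix P)
    (hrun : IsCorruptedRun μ P F G o x arm) {t : ℕ} (ht : 1 ≤ t) (i : ℤˣ) (k : Fin K) :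
    Integrable (fun ω => P k (arm i t ω)) μ := by
  refine integrable_of_measurable_of_abs_le (M := 1) ?_ fun ω => ?_
  · exact (measurable_of_finite fun a => P k a).comp
      ((hrun.measurable_arm t ht i).mono (F.le t) le_rfl)
  · rw [abs_of_nonneg (hP.mem_Icc k _).1]
    exact (hP.mem_Icc k _).2

theorem integral_regret [IsProbabilityMeasure μ] (hP : IsPreferenceMatrix P)
    (hrun : IsCorruptedRun μ P F G o x arm) (T : ℕ) (k : Fin K) :
    ∫ ω, regret P arm T k ω ∂μ = ∑ t ∈ Finset.Icc 1 T,
      1 / 2 * (∫ ω, P k (arm 1 t ω) ∂μ + ∫ ω, P k (arm (-1) t ω) ∂μ - 1) := by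
  have hi : ∀ t ∈ Finset.Icc 1 T, Integrable (fun ω => P k (arm 1 t ω) + P k (arm (-1) t ω)) μ :=
    fun t ht => (hrun.integrable_preference hP (Finset.mem_Icc.mp ht).1 1 k).add
      (hrun.integrable_preference hP (Finset.mem_Icc.mp ht).1 (-1) k)
  refine (integral_finsetSum _ fun t ht =>
    ((hi t ht).sub (integrable_const 1)).const_mul (1 / 2)).trans ?_
  refine Finset.sum_congr rfl fun t ht => ?_
  have ht1 := (Finset.mem_Icc.mp ht).1
  refine (integral_const_mul _ _).trans (congrArg _ ?_)
  refine (integral_sub (hi t ht) (integrable_const _)).trans ?_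
  rw [integral_add (hrun.integrable_preference hP ht1 1 k)
    (hrun.integrable_preference hP ht1 (-1) k)]
  simp

variable [NeZero K]

theorem integrable_sum_sqrt [IsProbabilityMeasure μ] (hrun : IsCorruptedRun μ P F G o x arm)
    (i : ℤˣ) {t : ℕ} (ht : 1 ≤ t) :
    Integrable (fun ω => ∑ j, √(playDist arm x i t ω j)) μ :=
  integrable_of_measurable_of_abs_le
    (Finset.measurable_sum _ fun j _ => (hrun.measurable_playDist_space i t j).sqrt)
    fun ω => abs_sum_sqrt_le (playDist_mem i ht ω)

theorem integrable_sum_sqrt_mul [IsProbabilityMeasure μ] (hrun : IsCorruptedRun μ P F G o x arm)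
    (i : ℤˣ) {t : ℕ} (ht : 1 ≤ t) :
    Integrable (fun ω => ∑ j, √(playDist arm x i t ω j) * (1 - playDist arm x i t ω j)) μ :=
  integrable_of_measurable_of_abs_le
    (Finset.measurable_sum _ fun j _ => (hrun.measurable_playDist_space i t j).sqrt.mul
      (measurable_const.sub (hrun.measurable_playDist_space i t j)))
    fun ω => abs_sum_sqrt_mul_le (playDist_mem i ht ω)

theorem integrable_roundBound [IsProbabilityMeasure μ] (hrun : IsCorruptedRun μ P F G o x arm)
    (i : ℤˣ) {t : ℕ} (ht : 1 ≤ t) :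
    Integrable (fun ω => roundBound t (playDist arm x i t ω)) μ := by
  unfold roundBound
  exact (((hrun.integrable_sum_sqrt i ht).sub (integrable_const _)).const_mul _).add
    (((hrun.integrable_sum_sqrt_mul i ht).const_mul _).add (integrable_const _))

/-- The stability of a single draw has denominators that may be small. Being nonnegative, it is at
most its average over the draw divided by a uniform lower bound on the weights, and that average is
already controlled. -/
theorem exists_abs_stability_le (hK : 2 ≤ K) (hrun : IsCorruptedRun μ P F G o x arm)
    (i : ℤˣ) {t : ℕ} (ht : 1 ≤ t) :
    ∃ M, ∀ a ω, |stability t (playDist arm x i t ω) a| ≤ M := by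
  obtain ⟨c, hc, hcp⟩ := hrun.exists_le_playDist i ht
  refine ⟨(1 / √(t : ℝ) * K + 2 / t) / c, fun a ω => ?_⟩
  have hpos := playDist_pos (arm := arm) (x := x) i ht ω
  have hlt : ∀ k, playDist arm x i t ω k < 1 := fun k => weights_lt_one hK ht _ k
  have hmem := playDist_mem (arm := arm) (x := x) i ht ω
  have hcp' := hcp ω a
  set w := playDist arm x i t ω
  have hnn := stability_nonneg ht hlt
  rw [abs_of_nonneg (hnn a), le_div_iff₀ hc, mul_comm]
  calc c * stability t w a ≤ w a * stability t w a := by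
        have := hnn a
        gcongr
    _ ≤ ∑ b, w b * stability t w b :=
        Finset.single_le_sum (f := fun b => w b * stability t w b)
          (fun b _ => mul_nonneg (hpos b).le (hnn b)) (Finset.mem_univ a)
    _ ≤ _ := (stability_expectation ht hpos hlt hmem.2).trans <| by
        gcongr
        exact (le_abs_self _).trans (abs_sum_sqrt_mul_le hmem)

/-- The expected regret of one player against the losses it faces. -/
theorem sum_integral_player_regret_le [IsProbabilityMeasure μ] (hK : 2 ≤ K)
    (hrun : IsCorruptedRun μ P F G o x arm) (i : ℤˣ) (T : ℕ) (k : Fin K) :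
    ∑ t ∈ Finset.Icc 1 T, ∫ ω, (x t ω (arm (-i) t ω) (arm i t ω) -
        lossEstimate (playDist arm x i t ω) (arm i t ω) (x t ω (arm (-i) t ω) (arm i t ω)) k) ∂μ ≤
      ∑ t ∈ Finset.Icc 1 T, ∫ ω, roundBound t (playDist arm x i t ω) ∂μ := by
  have hvec : ∀ t, Measurable fun ω => playDist arm x i t ω := fun t =>
    measurable_pi_lambda _ fun j => hrun.measurable_playDist_space i t j
  have hLi : ∀ t ∈ Finset.Icc 1 T, Integrable (fun ω => x t ω (arm (-i) t ω) (arm i t ω) -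
      lossEstimate (playDist arm x i t ω) (arm i t ω)
        (x t ω (arm (-i) t ω) (arm i t ω)) k) μ := fun t ht =>
    (hrun.integrable_observed (Finset.mem_Icc.mp ht).1 i).sub
      (hrun.integrable_lossEstimate (Finset.mem_Icc.mp ht).1 i k)
  have hPen : ∀ t : ℕ, 1 ≤ t → Integrable (fun ω => 2 * (√(t : ℝ) - √((t - 1 : ℕ) : ℝ)) *
      (∑ j, √(playDist arm x i t ω j) - 1)) μ := fun t ht =>
    ((hrun.integrable_sum_sqrt i ht).sub (integrable_const _)).const_mul _
  have hStab : ∀ t : ℕ, 1 ≤ t →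
      Integrable (fun ω => stability t (playDist arm x i t ω) (arm i t ω)) μ := fun t ht => by
    obtain ⟨M, hM⟩ := hrun.exists_abs_stability_le hK i ht
    refine integrable_of_measurable_of_abs_le (M := M) ?_ fun ω => hM _ ω
    have harm := (hrun.measurable_arm t ht i).mono (F.le t) le_rfl
    exact measurable_comp_arms (f := fun a _ ω => stability t (playDist arm x i t ω) a)
      (fun a _ => (measurable_stability t a).comp (hvec t)) harm harm
  have hR : ∀ t ∈ Finset.Icc 1 T, Integrable (fun ω =>
      2 * (√(t : ℝ) - √((t - 1 : ℕ) : ℝ)) * (∑ j, √(playDist arm x i t ω j) - 1)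
        + stability t (playDist arm x i t ω) (arm i t ω)) μ := fun t ht =>
    (hPen t (Finset.mem_Icc.mp ht).1).add (hStab t (Finset.mem_Icc.mp ht).1)
  rw [← integral_finsetSum _ hLi]
  refine (integral_mono (integrable_finsetSum _ hLi) (integrable_finsetSum _ hR) fun ω =>
    regret_pathwise hK (fun s => arm i s ω) (fun s => x s ω (arm (-i) s ω) (arm i s ω))
      (fun t ht => hrun.x_mem_Icc t ht ω _ _) T k).trans ?_
  rw [integral_finsetSum _ hR]
  refine Finset.sum_le_sum fun t ht => ?_
  have ht1 := (Finset.mem_Icc.mp ht).1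
  obtain ⟨M, hM⟩ := hrun.exists_abs_stability_le hK i ht1
  have hvecG : Measurable[G t] fun ω => playDist arm x i t ω :=
    @measurable_pi_lambda _ _ _ (G t) _ _ fun j => hrun.measurable_playDist_G i ht1 j
  have hMul := hrun.integrable_playDist_mul ht1 i
    (f := fun a ω => stability t (playDist arm x i t ω) a)
    (fun a => (measurable_stability t a).comp (hvec t)) hM
  unfold roundBound
  have hI := ((hrun.integrable_sum_sqrt_mul i ht1).const_mul (1 / √(t : ℝ))).add
    (integrable_const (2 / (t : ℝ)))
  refine (integral_add (hPen t ht1) (hStab t ht1)).trans_le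
    (le_trans ?_ (integral_add (hPen t ht1) hI).ge)
  refine add_le_add le_rfl ?_
  rw [hrun.integral_arm ht1 i (f := fun a ω => stability t (playDist arm x i t ω) a)
    (fun a => (measurable_stability t a).comp hvecG) hM]
  refine integral_mono (integrable_finsetSum _ fun a _ => hMul a) hI fun ω => ?_
  exact stability_expectation ht1 (playDist_pos i ht1 ω) (fun k => weights_lt_one hK ht1 _ k)
    (playDist_mem i ht1 ω).2

/-- The expected regret against any arm is bounded by the regret bounds of the two players and the
corruption of the duels of that arm. -/
theorem integral_regret_le [IsProbabilityMeasure μ] (hK : 2 ≤ K) (hP : IsPreferenceMatrix P)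
    (hrun : IsCorruptedRun μ P F G o x arm) (T : ℕ) (k : Fin K) :
    ∫ ω, regret P arm T k ω ∂μ ≤
      1 / 2 * (∑ t ∈ Finset.Icc 1 T, ∫ ω, roundBound t (playDist arm x 1 t ω) ∂μ
        + ∑ t ∈ Finset.Icc 1 T, ∫ ω, roundBound t (playDist arm x (-1) t ω) ∂μ)
      + ∫ ω, corruption o x T k ω ∂μ := by
  have h1 := hrun.sum_integral_player_regret_le hK 1 T k
  have h2 := hrun.sum_integral_player_regret_le hK (-1) T k
  rw [hrun.integral_regret hP]
  simp only [corruption]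
  rw [integral_finsetSum _ fun t ht =>
    hrun.integrable_corruption_round (Finset.mem_Icc.mp ht).1 k]
  have h3 : ∀ t ∈ Finset.Icc 1 T,
      1 / 2 * (∫ ω, P k (arm 1 t ω) ∂μ + ∫ ω, P k (arm (-1) t ω) ∂μ - 1) ≤
      1 / 2 * (∫ ω, (x t ω (arm (-1) t ω) (arm 1 t ω) - lossEstimate (playDist arm x 1 t ω)
          (arm 1 t ω) (x t ω (arm (-1) t ω) (arm 1 t ω)) k) ∂μ
        + ∫ ω, (x t ω (arm (- -1) t ω) (arm (-1) t ω) - lossEstimate (playDist arm x (-1) t ω)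
          (arm (-1) t ω) (x t ω (arm (- -1) t ω) (arm (-1) t ω)) k) ∂μ)
      + ∫ ω, ∑ k' ∈ Finset.univ.erase k, |o t ω k k' - x t ω k k'| ∂μ := by
    intro t ht
    have ht1 := (Finset.mem_Icc.mp ht).1
    rw [hrun.integral_player_regret_add ht1 k]
    linarith [hrun.integral_preference_le hP ht1 1 k, hrun.integral_preference_le hP ht1 (-1) k]
  refine (Finset.sum_le_sum h3).trans ?_
  rw [Finset.sum_add_distrib, ← Finset.mul_sum, Finset.sum_add_distrib]
  linarith

theorem integrable_sum_gap [IsProbabilityMeasure μ]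
    (hrun : IsCorruptedRun μ P F G o x arm) {t : ℕ} (ht : 1 ≤ t) (i : ℤˣ) (k₀ : Fin K) :
    Integrable (fun ω => ∑ k ∈ Finset.univ.erase k₀, gap P k₀ k * playDist arm x i t ω k) μ :=
  integrable_finsetSum _ fun k _ =>
    (integrable_of_measurable_of_abs_le (hrun.measurable_playDist_space i t k)
      fun ω => abs_playDist_le_one i ht ω k).const_mul _

/-- This exact form of the regret against the Condorcet winner is what can be subtracted in the
self-bounding step. -/
theorem integral_preference_eq [IsProbabilityMeasure μ] (hP : IsPreferenceMatrix P)
    (hrun : IsCorruptedRun μ P F G o x arm) {t : ℕ} (ht : 1 ≤ t) (i : ℤˣ) (k₀ : Fin K) :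
    ∫ ω, P k₀ (arm i t ω) ∂μ =
      ∫ ω, ∑ k ∈ Finset.univ.erase k₀, gap P k₀ k * playDist arm x i t ω k ∂μ + 1 / 2 := by
  rw [hrun.integral_arm ht i (f := fun a _ => P k₀ a) (fun a => measurable_const) (M := 1)
    (fun a _ => by rw [abs_of_nonneg (hP.mem_Icc k₀ a).1]; exact (hP.mem_Icc k₀ a).2)]
  have h1 : (1 / 2 : ℝ) = ∫ _ω, (1 / 2 : ℝ) ∂μ := by simp
  rw [h1, ← integral_add (hrun.integrable_sum_gap ht i k₀) (integrable_const _)]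
  refine integral_congr_ae (ae_of_all _ fun ω => ?_)
  beta_reduce
  have h2 : gap P k₀ k₀ = 0 := by
    have := hP.add_swap k₀ k₀
    rw [gap]
    linarith
  have h3 : ∑ k ∈ Finset.univ.erase k₀, gap P k₀ k * playDist arm x i t ω k
      = ∑ k, gap P k₀ k * playDist arm x i t ω k := by
    rw [← Finset.add_sum_erase _ _ (Finset.mem_univ k₀), h2, zero_mul, zero_add]
  rw [h3]
  simp only [gap, sub_mul, Finset.sum_sub_distrib, ← Finset.mul_sum,
    (playDist_mem (arm := arm) (x := x) i ht ω).2]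
  rw [mul_one, sub_add_cancel]
  exact Finset.sum_congr rfl fun _ _ => mul_comm _ _

theorem player_self_bounding [IsProbabilityMeasure μ] (hP : IsPreferenceMatrix P) {k₀ : Fin K}
    (hk₀ : IsCondorcetWinner P k₀) (hrun : IsCorruptedRun μ P F G o x arm) (i : ℤˣ) (T : ℕ) :
    2 * ∑ t ∈ Finset.Icc 1 T, ∫ ω, roundBound t (playDist arm x i t ω) ∂μ
      - ∑ t ∈ Finset.Icc 1 T,
          ∫ ω, ∑ k ∈ Finset.univ.erase k₀, gap P k₀ k * playDist arm x i t ω k ∂μ ≤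
      ∑ k ∈ Finset.univ.erase k₀, (4 * Real.log T + 12) / gap P k₀ k + 4 * Real.log T + 4 := by
  have hi : ∀ t ∈ Finset.Icc 1 T, Integrable (fun ω => 2 * roundBound t (playDist arm x i t ω)
      - ∑ k ∈ Finset.univ.erase k₀, gap P k₀ k * playDist arm x i t ω k) μ := fun t ht =>
    ((hrun.integrable_roundBound i (Finset.mem_Icc.mp ht).1).const_mul 2).sub
      (hrun.integrable_sum_gap (Finset.mem_Icc.mp ht).1 i k₀)
  have h1 : 2 * ∑ t ∈ Finset.Icc 1 T, ∫ ω, roundBound t (playDist arm x i t ω) ∂μ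
      - ∑ t ∈ Finset.Icc 1 T,
          ∫ ω, ∑ k ∈ Finset.univ.erase k₀, gap P k₀ k * playDist arm x i t ω k ∂μ =
      ∫ ω, ∑ t ∈ Finset.Icc 1 T, (2 * roundBound t (playDist arm x i t ω)
        - ∑ k ∈ Finset.univ.erase k₀, gap P k₀ k * playDist arm x i t ω k) ∂μ := by
    rw [integral_finsetSum _ hi, Finset.mul_sum, ← Finset.sum_sub_distrib]
    refine Finset.sum_congr rfl fun t ht => ?_
    have ht1 := (Finset.mem_Icc.mp ht).1
    rw [integral_sub ((hrun.integrable_roundBound i ht1).const_mul 2)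
      (hrun.integrable_sum_gap ht1 i k₀), integral_const_mul]
  rw [h1]
  refine (integral_mono (integrable_finsetSum _ hi) (integrable_const _) fun ω =>
    self_bounding k₀ (gap P k₀) (fun k hk => sub_pos.mpr (hk₀ k hk))
      (fun k => ?_) (fun t => playDist arm x i t ω) (fun t ht => playDist_mem i ht ω) T).trans
    (by simp)
  have := (hP.mem_Icc k₀ k).2
  rw [gap]
  linarith

end IsCorruptedRun

theorem minGap_nonneg {K : ℕ} {P : Matrix (Fin K) (Fin K) ℝ} {k₀ : Fin K}
    (hk₀ : IsCondorcetWinner P k₀) : 0 ≤ minGap P k₀ :=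
  Real.iInf_nonneg fun k => (sub_pos.mpr (hk₀ k k.2)).le

end DuelingBandits

/-- The first conclusion bounds the pseudo-regret with respect to the Condorcet winner; the second
bounds the pseudo-regret with respect to the best fixed arm, when the corruption of the duels of
each arm is bounded. -/
theorem mainTheorem3 {Ω : Type*} {mΩ : MeasurableSpace Ω} (μ : Measure Ω) [IsProbabilityMeasure μ]
    (K : ℕ) (hK : 2 ≤ K) (P : Matrix (Fin K) (Fin K) ℝ)
    (hP : DuelingBandits.IsPreferenceMatrix P)
    (cw : Fin K) (hcw : DuelingBandits.IsCondorcetWinner P cw)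
    (F : Filtration ℕ mΩ) (G : ℕ → MeasurableSpace Ω)
    (o x : ℕ → Ω → Matrix (Fin K) (Fin K) ℝ) (arm : ℤˣ → ℕ → Ω → Fin K)
    (hrun : DuelingBandits.IsCorruptedRun μ P F G o x arm)
    (T : ℕ) (hT : 1 ≤ T) (C : ℝ)
    (hC : ∫ ω, DuelingBandits.corruption o x T cw ω ∂μ ≤ C) :
    ∫ ω, DuelingBandits.regret P arm T cw ω ∂μ ≤
        ∑ k ∈ Finset.univ.erase cw, (4 * Real.log T + 12) / DuelingBandits.gap P cw k
          + 4 * Real.log T + 1 / DuelingBandits.minGap P cw + 3 / 2 * √(K : ℝ) + 8 + 2 * C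
    ∧ ((∀ k, ∫ ω, DuelingBandits.corruption o x T k ω ∂μ ≤ C) →
      (⨆ k, ∫ ω, DuelingBandits.regret P arm T k ω ∂μ) ≤
        ∑ k ∈ Finset.univ.erase cw, (4 * Real.log T + 12) / DuelingBandits.gap P cw k
          + 4 * Real.log T + 1 / DuelingBandits.minGap P cw + 3 / 2 * √(K : ℝ) + 8 + 2 * C) := by
  have : NeZero K := ⟨by omega⟩
  have hreg := hrun.integral_regret_le hK hP T
  have hcwreg := hreg cw
  have hself1 := hrun.player_self_bounding hP hcw 1 T
  have hself2 := hrun.player_self_bounding hP hcw (-1) T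
  have hR : ∫ ω, DuelingBandits.regret P arm T cw ω ∂μ =
      1 / 2 * (∑ t ∈ Finset.Icc 1 T, ∫ ω, ∑ k ∈ Finset.univ.erase cw,
          DuelingBandits.gap P cw k * DuelingBandits.playDist arm x 1 t ω k ∂μ
        + ∑ t ∈ Finset.Icc 1 T, ∫ ω, ∑ k ∈ Finset.univ.erase cw,
          DuelingBandits.gap P cw k * DuelingBandits.playDist arm x (-1) t ω k ∂μ) := by
    rw [hrun.integral_regret hP, ← Finset.sum_add_distrib, Finset.mul_sum]
    refine Finset.sum_congr rfl fun t ht => ?_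
    have ht1 := (Finset.mem_Icc.mp ht).1
    rw [hrun.integral_preference_eq hP ht1 1 cw, hrun.integral_preference_eq hP ht1 (-1) cw]
    ring
  have hmin : 0 ≤ 1 / DuelingBandits.minGap P cw :=
    one_div_nonneg.mpr (DuelingBandits.minGap_nonneg hcw)
  have hsqrt : 0 ≤ 3 / 2 * √(K : ℝ) := by positivity
  -- For the winner, twice `hcwreg` minus the identity `hR` meets the average of `hself1` and
  -- `hself2`. For another arm, the same facts bound half the sum of the players' totals by the
  -- logarithmic term plus `C`, and `hreg k` adds one more `C`. The self-bounding constant 4 fits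
  -- into 8; the terms in `minGap` and `√K` are needed only as nonnegative slack.
  refine ⟨by linarith, fun hCk => ciSup_le fun k => ?_⟩
  have := hreg k
  have := hCk k
  linarith
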